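/- For an integer $n$ let $K_n\subset S^3$ be the twist knot with $n$ full twists: the knot whose standard diagram consists of a clasp of two positive crossings and of a row of $2|n|$ crossings between antiparallel strands, which are negative if $n>0$ and positive if $n<0$ (so $K_0$ is the unknot, $K_1$ the figure-eight knot, $K_2$ the stevedore knot; the Alexander polynomial of $K_n$ is $nt^2-(2n+1)t+n$). A rational Seifert form is a bilinear form $A$ on a finite-dimensional $\mathbb{Q}$-vector space such that $A-A^T$ is nonsingular; it is metabolic if it vanishes on a subspace of half the dimension, and two such forms $A,B$ are concordant if $A\oplus(-B)$ is metabolic. The concordance classes form an abelian group $\mathcal{G}$ under orthogonal sum. For a positive integer $r$ let $i_r\colon\mathcal{G}\to\mathcal{G}$ be the homomorphism (given by taking $r$ parallel copies of a Seifert surface) that sends the class of $A$ to the class of the $r\times r$ block matrix with blocks $A$ on and above the diagonal and $A^T$ below the diagonal. Cha's rational algebraic concordance group is defined as the direct limit of the groups $\mathcal{G}_c=\mathcal{G}$ over the positive integers $c$ (the complexities), ordered by divisibility, with the maps $i_{d/c}\colon\mathcal{G}_c\to\mathcal{G}_d$ for $c\mid d$; $\mathcal{AC}_\mathbb{Q}$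 is the subgroup of the classes of knots in $S^3$, where the class of a knot is the image of its Seifert form in $\mathcal{G}_1$. A knot is called algebraically rationally slice if its class is zero. Theorem. For every integer $n$, the twist knot $K_n$ is algebraically rationally slice if and only if there is an integer $k$ with $n=k(k-1)$ or $n=k^2$. -/

import Mathlib

/-! ## Bilinear forms

All vector spaces are rational and finite-dimensional; the forms are not assumed symmetric. -/

namespace RatForm

section Forms

variable {U V W : Type} [AddCommGroup U] [Module ℚ U] [AddCommGroup V] [Module ℚ V]
  [AddCommGroup W] [Module ℚ W]

/-- The skew-symmetrization `B x y - B y x` is nonsingular. -/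
def Nonsing (B : V →ₗ[ℚ] V →ₗ[ℚ] ℚ) : Prop :=
  ∀ x, (∀ y, B x y = B y x) → x = 0

/-- A form is metabolic if it vanishes on a half-dimensional subspace. -/
def Metabolic (B : V →ₗ[ℚ] V →ₗ[ℚ] ℚ) : Prop :=
  ∃ L : Submodule ℚ V, 2 * Module.finrank ℚ L = Module.finrank ℚ V ∧
    ∀ x ∈ L, ∀ y ∈ L, B x y = 0

/-- The orthogonal sum of two forms. -/
def sum (B : V →ₗ[ℚ] V →ₗ[ℚ] ℚ) (C : W →ₗ[ℚ] W →ₗ[ℚ] ℚ) :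
    V × W →ₗ[ℚ] V × W →ₗ[ℚ] ℚ :=
  B.compl₁₂ (LinearMap.fst ℚ V W) (LinearMap.fst ℚ V W) +
    C.compl₁₂ (LinearMap.snd ℚ V W) (LinearMap.snd ℚ V W)

/-- If `B` is the Seifert form of a surface, then `parallel r B` is the Seifert form of `r` parallel
copies of that surface. As a block matrix, if `B` has matrix `A`, then `parallel r B` has the
blocks `A` on and above the diagonal and the blocks `Aᵀ` below it. -/
def parallel (r : ℕ) (B : V →ₗ[ℚ] V →ₗ[ℚ] ℚ) : (Fin r → V) →ₗ[ℚ] (Fin r → V) →ₗ[ℚ] ℚ :=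
  ∑ i : Fin r, ∑ j : Fin r, (if i ≤ j then B else B.flip).compl₁₂
    (LinearMap.proj (R := ℚ) (φ := fun _ : Fin r => V) i)
    (LinearMap.proj (R := ℚ) (φ := fun _ : Fin r => V) j)

@[simp] theorem sum_apply (B : V →ₗ[ℚ] V →ₗ[ℚ] ℚ) (C : W →ₗ[ℚ] W →ₗ[ℚ] ℚ) (x y : V × W) :
    sum B C x y = B x.1 y.1 + C x.2 y.2 := rfl

theorem parallel_apply (r : ℕ) (B : V →ₗ[ℚ] V →ₗ[ℚ] ℚ) (x y : Fin r → V) :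
    parallel r B x y = ∑ i, ∑ j, if i ≤ j then B (x i) (y j) else B (y j) (x i) := by
  simp only [parallel, LinearMap.sum_apply, LinearMap.compl₁₂_apply]
  refine Finset.sum_congr rfl fun i _ => Finset.sum_congr rfl fun j _ => ?_
  split_ifs <;> simp

theorem Nonsing.neg {B : V →ₗ[ℚ] V →ₗ[ℚ] ℚ} (h : Nonsing B) : Nonsing (-B) :=
  fun x hx => h x fun y => by simpa using hx y

theorem Nonsing.sum {B : V →ₗ[ℚ] V →ₗ[ℚ] ℚ} {C : W →ₗ[ℚ] W →ₗ[ℚ] ℚ} (hB : Nonsing B)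
    (hC : Nonsing C) : Nonsing (sum B C) :=
  fun x hx => Prod.ext (hB _ fun y => by simpa using hx (y, 0))
    (hC _ fun y => by simpa using hx (0, y))

theorem parallel_sub (r : ℕ) (B : V →ₗ[ℚ] V →ₗ[ℚ] ℚ) (x y : Fin r → V) :
    parallel r B x y - parallel r B y x = ∑ i, (B (x i) (y i) - B (y i) (x i)) := by
  rw [parallel_apply, parallel_apply, Finset.sum_comm (f := fun i j => ite (i ≤ j) (B (y i) (x j)) _),
    ← Finset.sum_sub_distrib]
  refine Finset.sum_congr rfl fun i _ => ?_
  rw [← Finset.sum_sub_distrib, Finset.sum_eq_single i]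
  · simp
  · intro j _ hj
    rcases lt_or_gt_of_ne hj with h | h
    · simp [h.le, not_le.2 h]
    · simp [h.le, not_le.2 h]
  · simp

theorem Nonsing.parallel {B : V →ₗ[ℚ] V →ₗ[ℚ] ℚ} (h : Nonsing B) (r : ℕ) :
    Nonsing (parallel r B) := by
  classical
  intro x hx
  funext k
  refine h _ fun y => ?_
  have key := parallel_sub r B x (Pi.single k y)
  rw [hx, sub_self, Finset.sum_eq_single k] at key
  · simpa using (sub_eq_zero.1 key.symm)
  · intro i _ hi
    simp [Pi.single_eq_of_ne hi]
  · simp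

theorem Metabolic.of_equiv {B : V →ₗ[ℚ] V →ₗ[ℚ] ℚ} {C : W →ₗ[ℚ] W →ₗ[ℚ] ℚ} (e : V ≃ₗ[ℚ] W)
    (he : ∀ x y, C (e x) (e y) = B x y) (h : Metabolic B) : Metabolic C := by
  obtain ⟨L, hL, hz⟩ := h
  refine ⟨L.map e.toLinearMap, ?_, ?_⟩
  · rw [LinearEquiv.finrank_map_eq e L, hL, LinearEquiv.finrank_eq e]
  · rintro _ ⟨x, hx, rfl⟩ _ ⟨y, hy, rfl⟩
    simpa [he] using hz x hx y hy

theorem Metabolic.neg {B : V →ₗ[ℚ] V →ₗ[ℚ] ℚ} (h : Metabolic B) : Metabolic (-B) := by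
  obtain ⟨L, hL, hz⟩ := h
  exact ⟨L, hL, fun x hx y hy => by simp [hz x hx y hy]⟩

theorem finrank_prod_submodule [FiniteDimensional ℚ V] [FiniteDimensional ℚ W]
    (L : Submodule ℚ V) (M : Submodule ℚ W) :
    Module.finrank ℚ (L.prod M) = Module.finrank ℚ L + Module.finrank ℚ M := by
  have h : L.prod M = LinearMap.range (L.subtype.prodMap M.subtype) := by
    rw [LinearMap.range_prodMap, Submodule.range_subtype, Submodule.range_subtype]
  rw [h, LinearMap.finrank_range_of_inj, Module.finrank_prod]
  exact Prod.map_injective.2 ⟨Subtype.val_injective, Subtype.val_injective⟩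

theorem Metabolic.sum [FiniteDimensional ℚ V] [FiniteDimensional ℚ W]
    {B : V →ₗ[ℚ] V →ₗ[ℚ] ℚ} {C : W →ₗ[ℚ] W →ₗ[ℚ] ℚ} (hB : Metabolic B)
    (hC : Metabolic C) : Metabolic (sum B C) := by
  obtain ⟨L, hL, hz⟩ := hB
  obtain ⟨M, hM, hw⟩ := hC
  refine ⟨L.prod M, ?_, ?_⟩
  · rw [finrank_prod_submodule, Module.finrank_prod]
    omega
  · rintro x ⟨hx1, hx2⟩ y ⟨hy1, hy2⟩
    rw [sum_apply, hz _ hx1 _ hy1, hw _ hx2 _ hy2, add_zero]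

theorem Metabolic.parallel [FiniteDimensional ℚ V] {B : V →ₗ[ℚ] V →ₗ[ℚ] ℚ} (h : Metabolic B)
    (r : ℕ) : Metabolic (parallel r B) := by
  obtain ⟨L, hL, hz⟩ := h
  refine ⟨LinearMap.range (L.subtype.compLeft (Fin r)), ?_, ?_⟩
  · rw [LinearMap.finrank_range_of_inj, Module.finrank_pi_fintype,
      Module.finrank_pi_fintype, ← hL, Finset.mul_sum]
    · intro x y hxy
      funext i
      exact Subtype.ext (congrFun hxy i)
  · rintro _ ⟨x, rfl⟩ _ ⟨y, rfl⟩
    rw [parallel_apply]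
    refine Finset.sum_eq_zero fun i _ => Finset.sum_eq_zero fun j _ => ?_
    split_ifs
    · exact hz _ (x i).2 _ (y j).2
    · exact hz _ (y j).2 _ (x i).2

/-- Isometry of forms. -/
def Isometric (B : V →ₗ[ℚ] V →ₗ[ℚ] ℚ) (C : W →ₗ[ℚ] W →ₗ[ℚ] ℚ) : Prop :=
  ∃ e : V ≃ₗ[ℚ] W, ∀ x y, C (e x) (e y) = B x y

theorem isometric_comm (B : V →ₗ[ℚ] V →ₗ[ℚ] ℚ) (C : W →ₗ[ℚ] W →ₗ[ℚ] ℚ) :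
    Isometric (sum B C) (sum C B) :=
  ⟨LinearEquiv.prodComm ℚ V W, fun x y => by simp [add_comm]⟩

theorem isometric_assoc (A : U →ₗ[ℚ] U →ₗ[ℚ] ℚ) (B : V →ₗ[ℚ] V →ₗ[ℚ] ℚ)
    (C : W →ₗ[ℚ] W →ₗ[ℚ] ℚ) : Isometric (sum (sum A B) C) (sum A (sum B C)) :=
  ⟨LinearEquiv.prodAssoc ℚ U V W, fun x y => by simp [add_assoc]⟩

theorem isometric_sum_zero (B : V →ₗ[ℚ] V →ₗ[ℚ] ℚ) :
    Isometric (sum B (0 : PUnit.{1} →ₗ[ℚ] PUnit.{1} →ₗ[ℚ] ℚ)) B :=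
  ⟨LinearEquiv.prodUnique, fun x y => by simp⟩

theorem isometric_neg_sum (B : V →ₗ[ℚ] V →ₗ[ℚ] ℚ) (C : W →ₗ[ℚ] W →ₗ[ℚ] ℚ) :
    Isometric (-(sum B C)) (sum (-B) (-C)) :=
  ⟨LinearEquiv.refl ℚ _, fun x y => by simp [add_comm]⟩

theorem isometric_parallel_sum (r : ℕ) (B : V →ₗ[ℚ] V →ₗ[ℚ] ℚ) (C : W →ₗ[ℚ] W →ₗ[ℚ] ℚ) :
    Isometric (parallel r (sum B C)) (sum (parallel r B) (parallel r C)) := by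
  refine ⟨⟨⟨⟨fun x => (fun i => (x i).1, fun i => (x i).2), fun _ _ => rfl⟩, fun _ _ => rfl⟩,
    fun x i => (x.1 i, x.2 i), fun _ => rfl, fun _ => rfl⟩, fun x y => ?_⟩
  simp only [sum_apply, parallel_apply, ← Finset.sum_add_distrib]
  refine Finset.sum_congr rfl fun i _ => Finset.sum_congr rfl fun j _ => ?_
  split_ifs <;> rfl

theorem parallel_neg (r : ℕ) (B : V →ₗ[ℚ] V →ₗ[ℚ] ℚ) : parallel r (-B) = -parallel r B := by
  refine LinearMap.ext fun x => LinearMap.ext fun y => ?_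
  simp only [parallel_apply, LinearMap.neg_apply, ← Finset.sum_neg_distrib]
  refine Finset.sum_congr rfl fun i _ => Finset.sum_congr rfl fun j _ => ?_
  split_ifs <;> rfl

theorem isometric_parallel_one (B : V →ₗ[ℚ] V →ₗ[ℚ] ℚ) : Isometric (parallel 1 B) B :=
  ⟨LinearEquiv.funUnique (Fin 1) ℚ V, fun x y => by simp [parallel_apply]⟩

theorem isometric_parallel_parallel (r s : ℕ) (B : V →ₗ[ℚ] V →ₗ[ℚ] ℚ) :
    Isometric (parallel r (parallel s B)) (parallel (s * r) B) := by
  refine ⟨⟨⟨⟨fun x k => x (finProdFinEquiv.symm k).2 (finProdFinEquiv.symm k).1, fun _ _ => rfl⟩,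
    fun _ _ => rfl⟩, fun x i k => x (finProdFinEquiv (k, i)),
    fun x => by funext i k; simp, fun x => by
        funext k
        change x (finProdFinEquiv (finProdFinEquiv.symm k)) = x k
        rw [Equiv.apply_symm_apply]⟩, fun x y => ?_⟩
  have hle : ∀ (a b : Fin s) (i j : Fin r),
      finProdFinEquiv (a, i) ≤ finProdFinEquiv (b, j) ↔ a < b ∨ a = b ∧ i ≤ j := by
    intro a b i j
    have hi := i.2
    have hj := j.2
    simp only [Fin.le_def, Fin.lt_def, Fin.ext_iff, finProdFinEquiv_apply_val]
    rcases lt_trichotomy (a : ℕ) b with h | h | h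
    · have := Nat.mul_le_mul_left r (Nat.succ_le_of_lt h)
      rw [Nat.mul_succ] at this
      omega
    · rw [h]
      omega
    · have := Nat.mul_le_mul_left r (Nat.succ_le_of_lt h)
      rw [Nat.mul_succ] at this
      omega
  have key : ∀ i j : Fin r, (if i ≤ j then parallel s B (x i) (y j)
      else parallel s B (y j) (x i)) =
      ∑ a, ∑ b, if finProdFinEquiv (a, i) ≤ finProdFinEquiv (b, j)
        then B (x i a) (y j b) else B (y j b) (x i a) := by
    intro i j
    split_ifs with hij
    · rw [parallel_apply]
      refine Finset.sum_congr rfl fun a _ => Finset.sum_congr rfl fun b _ => ?_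
      refine if_congr ?_ rfl rfl
      rw [hle, le_iff_lt_or_eq]
      simp [hij]
    · rw [parallel_apply, Finset.sum_comm]
      refine Finset.sum_congr rfl fun a _ => Finset.sum_congr rfl fun b _ => ?_
      have h1 : finProdFinEquiv (a, i) ≤ finProdFinEquiv (b, j) ↔ ¬ b ≤ a := by
        rw [hle, not_le]
        simp [hij]
      by_cases hab : b ≤ a
      · rw [if_pos hab, if_neg (fun h => h1.1 h hab)]
      · rw [if_neg hab, if_pos (h1.2 hab)]
  rw [parallel_apply, parallel_apply]
  simp only [key]
  rw [← finProdFinEquiv.sum_comp, Fintype.sum_prod_type_right]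
  refine Finset.sum_congr rfl fun i _ => ?_
  rw [Finset.sum_comm, ← finProdFinEquiv.sum_comp, Fintype.sum_prod_type_right]
  refine Finset.sum_congr rfl fun j _ => ?_
  rw [Finset.sum_comm]
  refine Finset.sum_congr rfl fun a _ => Finset.sum_congr rfl fun b _ => ?_
  have hx : ∀ (z : Fin r → Fin s → V) (a : Fin s) (i : Fin r),
      z (finProdFinEquiv.symm (finProdFinEquiv (a, i))).2
        (finProdFinEquiv.symm (finProdFinEquiv (a, i))).1 = z i a := by
    intro z a i
    rw [Equiv.symm_apply_apply]
  rw [← hx x a i, ← hx y b j]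
  rfl

theorem metabolic_of_isometry [FiniteDimensional ℚ V] [FiniteDimensional ℚ W]
    {B : V →ₗ[ℚ] V →ₗ[ℚ] ℚ} {C : W →ₗ[ℚ] W →ₗ[ℚ] ℚ} (e : V ≃ₗ[ℚ] W)
    (he : ∀ x y, C (e x) (e y) = B x y) : Metabolic (RatForm.sum B (-C)) := by
  refine ⟨LinearMap.graph e.toLinearMap, ?_, ?_⟩
  · rw [LinearMap.graph_eq_range_prod, LinearMap.finrank_range_of_inj, Module.finrank_prod,
      ← LinearEquiv.finrank_eq e]
    · ring
    · intro x y hxy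
      exact (Prod.ext_iff.1 hxy).1
  · intro x hx y hy
    rw [LinearMap.mem_graph_iff] at hx hy
    simp [hx, hy, he]

/-- A subspace on which a nonsingular form vanishes and which has half the dimension is its own
orthogonal complement. -/
theorem mem_of_orthogonal [FiniteDimensional ℚ V] {B : V →ₗ[ℚ] V →ₗ[ℚ] ℚ} (hB : Nonsing B)
    {L : Submodule ℚ V} (hL : 2 * Module.finrank ℚ L = Module.finrank ℚ V)
    (hz : ∀ x ∈ L, ∀ y ∈ L, B x y = 0) {x : V} (hx : ∀ y ∈ L, B y x = B x y) : x ∈ L := by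
  let ω : LinearMap.BilinForm ℚ V := B - B.flip
  have hω : ∀ a b, ω a b = B a b - B b a := fun a b => rfl
  have hker : LinearMap.ker ω = ⊥ := by
    rw [LinearMap.ker_eq_bot']
    intro a ha
    refine hB a fun b => ?_
    have := hω a b
    rw [ha] at this
    exact sub_eq_zero.1 (by simpa using this.symm)
  have hfin := LinearMap.BilinForm.finrank_add_finrank_orthogonal' (B := ω) L
  rw [hker, inf_bot_eq, finrank_bot, add_zero] at hfin
  have hle : L ≤ ω.orthogonal L := fun a ha b hb => by
    change ω b a = 0
    rw [hω, hz _ hb _ ha, hz _ ha _ hb, sub_zero]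
  rw [Submodule.eq_of_le_of_finrank_eq hle (by omega)]
  intro b hb
  change ω b x = 0
  rw [hω, hx b hb, sub_self]

theorem finrank_orthogonal [FiniteDimensional ℚ V] {B : V →ₗ[ℚ] V →ₗ[ℚ] ℚ} (hB : Nonsing B)
    (I Z : Submodule ℚ V) (hZ : ∀ x, x ∈ Z ↔ ∀ y ∈ I, B y x = B x y) :
    Module.finrank ℚ I + Module.finrank ℚ Z = Module.finrank ℚ V := by
  let ω : LinearMap.BilinForm ℚ V := B - B.flip
  have hω : ∀ a b, ω a b = B a b - B b a := fun a b => rfl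
  have hker : LinearMap.ker ω = ⊥ := by
    rw [LinearMap.ker_eq_bot']
    intro a ha
    refine hB a fun b => ?_
    have := hω a b
    rw [ha] at this
    exact sub_eq_zero.1 (by simpa using this.symm)
  have hfin := LinearMap.BilinForm.finrank_add_finrank_orthogonal' (B := ω) I
  rw [hker, inf_bot_eq, finrank_bot, add_zero] at hfin
  have : Z = ω.orthogonal I := by
    ext x
    rw [hZ]
    refine forall₂_congr fun y _ => ?_
    change _ ↔ ω y x = 0
    rw [hω, sub_eq_zero]
  rw [this, hfin]

theorem finrank_map_add [FiniteDimensional ℚ V] (p : Submodule ℚ V) (g : V →ₗ[ℚ] W) :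
    Module.finrank ℚ (p.map g) + Module.finrank ℚ (p ⊓ LinearMap.ker g : Submodule ℚ V) =
      Module.finrank ℚ p := by
  have h := LinearMap.finrank_range_add_finrank_ker (g.domRestrict p)
  rw [LinearMap.range_domRestrict, LinearMap.ker_domRestrict] at h
  have e : p ⊓ LinearMap.ker g = ((LinearMap.ker g).submoduleOf p).map p.subtype :=
    (Submodule.map_comap_subtype p _).symm
  rw [← h, e, Submodule.finrank_map_subtype_eq]
  rfl

theorem metabolic_trans [FiniteDimensional ℚ U] [FiniteDimensional ℚ V] [FiniteDimensional ℚ W]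
    {A : U →ₗ[ℚ] U →ₗ[ℚ] ℚ} {B : V →ₗ[ℚ] V →ₗ[ℚ] ℚ} {C : W →ₗ[ℚ] W →ₗ[ℚ] ℚ}
    (hA : Nonsing A) (hB : Nonsing B) (hC : Nonsing C)
    (hAB : Metabolic (RatForm.sum A (-B))) (hBC : Metabolic (RatForm.sum B (-C))) :
    Metabolic (RatForm.sum A (-C)) := by
  obtain ⟨H, hH, hHz⟩ := hAB
  obtain ⟨K, hK, hKz⟩ := hBC
  -- the maps `(a, b), (b', c) ↦ b - b'`, `(a, c)`, `b` on `H × K`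
  let β : (U × V) × (V × W) →ₗ[ℚ] V := LinearMap.snd ℚ U V ∘ₗ LinearMap.fst ℚ (U × V) (V × W)
  let δ : (U × V) × (V × W) →ₗ[ℚ] V :=
    β - LinearMap.fst ℚ V W ∘ₗ LinearMap.snd ℚ (U × V) (V × W)
  let π : (U × V) × (V × W) →ₗ[ℚ] U × W :=
    (LinearMap.fst ℚ U V ∘ₗ LinearMap.fst ℚ (U × V) (V × W)).prod
      (LinearMap.snd ℚ V W ∘ₗ LinearMap.snd ℚ (U × V) (V × W))
  have hβ : ∀ p, β p = p.1.2 := fun p => rfl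
  have hδ : ∀ p, δ p = p.1.2 - p.2.1 := fun p => rfl
  have hπ : ∀ p, π p = (p.1.1, p.2.2) := fun p => rfl
  let X := H.prod K
  let Y := X ⊓ LinearMap.ker δ
  have hY : ∀ a b b' c, ((a, b), (b', c)) ∈ Y ↔ ((a, b) ∈ H ∧ (b', c) ∈ K) ∧ b = b' := by
    intro a b b' c
    rw [Submodule.mem_inf, Submodule.mem_prod, LinearMap.mem_ker, hδ, sub_eq_zero]
  have hbot : Y ⊓ LinearMap.ker π ⊓ LinearMap.ker β = ⊥ := by
    rw [eq_bot_iff]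
    rintro ⟨⟨a, b⟩, ⟨b', c⟩⟩ ⟨⟨h1, h2⟩, h3⟩
    have h1 := (hY _ _ _ _).1 h1
    have h2 : (a, c) = 0 := h2
    have h3 : b = 0 := h3
    simp only [Prod.mk_eq_zero] at h2
    simp [h2.1, h2.2, h3, ← h1.2]
  have hrange : ∀ x, x ∈ (Y ⊓ LinearMap.ker π).map β ↔ ∀ y ∈ X.map δ, B y x = B x y := by
    intro x
    constructor
    · rintro ⟨⟨⟨a, b⟩, ⟨b', c⟩⟩, ⟨h0, h2⟩, rfl⟩ _ ⟨⟨⟨u, v⟩, ⟨v', w⟩⟩, ⟨h5, h6⟩, rfl⟩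
      obtain ⟨⟨h1, h3⟩, rfl⟩ := (hY _ _ _ _).1 h0
      have h2 : (a, c) = 0 := h2
      simp only [Prod.mk_eq_zero] at h2
      obtain ⟨rfl, rfl⟩ := h2
      rw [hβ, hδ]
      have e1 := hHz _ h1 _ h5
      have e2 := hHz _ h5 _ h1
      have e3 := hKz _ h3 _ h6
      have e4 := hKz _ h6 _ h3
      simp at e1 e2 e3 e4
      simp [e1, e2, e3, e4]
    · intro hx
      have m1 : ((0 : U), x) ∈ H := by
        refine mem_of_orthogonal (hA.sum hB.neg) hH hHz ?_
        rintro ⟨u, v⟩ huv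
        have := hx _ ⟨((u, v), 0), ⟨huv, K.zero_mem⟩, rfl⟩
        rw [hδ] at this
        simp at this
        simp [this]
      have m2 : (x, (0 : W)) ∈ K := by
        refine mem_of_orthogonal (hB.sum hC.neg) hK hKz ?_
        rintro ⟨u, v⟩ huv
        have := hx _ ⟨(0, (u, v)), ⟨H.zero_mem, huv⟩, rfl⟩
        rw [hδ] at this
        simp at this
        simp [this]
      exact ⟨((0, x), (x, 0)), ⟨(hY _ _ _ _).2 ⟨⟨m1, m2⟩, rfl⟩, rfl⟩, rfl⟩
  have d1 := finrank_orthogonal hB _ _ hrange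
  have d2 := finrank_map_add X δ
  have d3 := finrank_map_add Y π
  have d4 := finrank_map_add (Y ⊓ LinearMap.ker π) β
  rw [hbot, finrank_bot] at d4
  have d5 := finrank_prod_submodule H K
  rw [Module.finrank_prod] at hH hK
  change Module.finrank ℚ (X.map δ) + Module.finrank ℚ Y = _ at d2
  change Module.finrank ℚ X = _ at d5
  refine ⟨Y.map π, ?_, ?_⟩
  · rw [Module.finrank_prod]
    omega
  · rintro _ ⟨⟨⟨a, b⟩, ⟨b', c⟩⟩, h0, rfl⟩ _ ⟨⟨⟨u, v⟩, ⟨v', w⟩⟩, h0', rfl⟩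
    obtain ⟨⟨h1, h3⟩, rfl⟩ := (hY _ _ _ _).1 h0
    obtain ⟨⟨h2, h4⟩, rfl⟩ := (hY _ _ _ _).1 h0'
    rw [hπ, hπ]
    have e1 := hHz _ h1 _ h2
    have e2 := hKz _ h3 _ h4
    simp at e1 e2 ⊢
    linarith

end Forms

end RatForm

/-! ## The rational algebraic concordance group -/

/-- A rational Seifert form: a bilinear form on a finite-dimensional rational vector space whose
skew-symmetrization (the intersection form) is nonsingular. -/
structure SeifertForm : Type 1 where
  V : Type
  [group : AddCommGroup V]
  [module : Module ℚ V]
  [finite : FiniteDimensional ℚ V]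
  form : V →ₗ[ℚ] V →ₗ[ℚ] ℚ
  nonsing : RatForm.Nonsing form

namespace SeifertForm

attribute [instance] SeifertForm.group SeifertForm.module SeifertForm.finite

/-- The form on the zero space. -/
abbrev zero : SeifertForm where
  V := PUnit
  form := 0
  nonsing _ _ := rfl

/-- The form with the opposite sign. -/
abbrev neg (S : SeifertForm) : SeifertForm where
  V := S.V
  form := -S.form
  nonsing := S.nonsing.neg

/-- The orthogonal sum. -/
abbrev add (S T : SeifertForm) : SeifertForm where
  V := S.V × T.V
  form := RatForm.sum S.form T.form
  nonsing := S.nonsing.sum T.nonsing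

/-- The Seifert form of `r` parallel copies. -/
abbrev parallel (r : ℕ) (S : SeifertForm) : SeifertForm where
  V := Fin r → S.V
  form := RatForm.parallel r S.form
  nonsing := S.nonsing.parallel r

/-- `S` and `T` are concordant if `S ⊕ (-T)` is metabolic. -/
def Concordant (S T : SeifertForm) : Prop := RatForm.Metabolic (RatForm.sum S.form (-T.form))

theorem Concordant.of_isometric {S T : SeifertForm} (h : RatForm.Isometric S.form T.form) :
    Concordant S T := by
  obtain ⟨e, he⟩ := h
  exact RatForm.metabolic_of_isometry e he

theorem Concordant.refl (S : SeifertForm) : Concordant S S :=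
  Concordant.of_isometric ⟨LinearEquiv.refl ℚ S.V, fun _ _ => rfl⟩

theorem Concordant.symm {S T : SeifertForm} (h : Concordant S T) : Concordant T S := by
  refine RatForm.Metabolic.of_equiv (LinearEquiv.prodComm ℚ S.V T.V) (fun x y => ?_)
    (RatForm.Metabolic.neg h)
  simp [add_comm]

theorem Concordant.trans {S T R : SeifertForm} (h : Concordant S T) (h' : Concordant T R) :
    Concordant S R :=
  RatForm.metabolic_trans S.nonsing T.nonsing R.nonsing h h'

instance setoid : Setoid SeifertForm where
  r := Concordant
  iseqv := ⟨Concordant.refl, Concordant.symm, Concordant.trans⟩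

theorem Concordant.neg {S T : SeifertForm} (h : Concordant S T) :
    Concordant S.neg T.neg := by
  obtain ⟨e, he⟩ := RatForm.isometric_neg_sum S.form (-T.form)
  exact RatForm.Metabolic.of_equiv e he (RatForm.Metabolic.neg h)

theorem Concordant.add {S T S' T' : SeifertForm} (h : Concordant S S') (h' : Concordant T T') :
    Concordant (S.add T) (S'.add T') := by
  refine RatForm.Metabolic.of_equiv (C := RatForm.sum (RatForm.sum S.form T.form)
    (-(RatForm.sum S'.form T'.form))) (LinearEquiv.prodProdProdComm ℚ S.V S'.V T.V T'.V)
    (fun x y => ?_) (RatForm.Metabolic.sum h h')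
  simp
  ring

theorem Concordant.parallel {S T : SeifertForm} (h : Concordant S T) (r : ℕ) :
    Concordant (S.parallel r) (T.parallel r) := by
  obtain ⟨e, he⟩ := RatForm.isometric_parallel_sum r S.form (-T.form)
  rw [RatForm.parallel_neg] at he
  exact RatForm.Metabolic.of_equiv e he (RatForm.Metabolic.parallel h r)

theorem Concordant.neg_add (S : SeifertForm) : Concordant (S.neg.add S) zero := by
  refine RatForm.Metabolic.of_equiv (B := RatForm.sum S.form (-S.form))
    (C := RatForm.sum (RatForm.sum (-S.form) S.form) (-(0 : PUnit.{1} →ₗ[ℚ] PUnit.{1} →ₗ[ℚ] ℚ)))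
    ((LinearEquiv.prodComm ℚ S.V S.V).trans
      (LinearEquiv.prodUnique (R := ℚ) (M := S.V × S.V) (M₂ := PUnit.{1})).symm)
    (fun x y => ?_) (Concordant.refl S)
  simp [add_comm]

end SeifertForm

/-- Concordance classes of rational Seifert forms. -/
def SeifertConcordanceGroup : Type 1 := Quotient SeifertForm.setoid

namespace SeifertConcordanceGroup

open SeifertForm

/-- The class of a Seifert form. -/
def mk (S : SeifertForm) : SeifertConcordanceGroup := Quotient.mk SeifertForm.setoid S

theorem mk_eq_of_isometric {S T : SeifertForm} (h : RatForm.Isometric S.form T.form) :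
    mk S = mk T :=
  Quotient.sound (Concordant.of_isometric h)

instance : Zero SeifertConcordanceGroup := ⟨mk SeifertForm.zero⟩

instance : Add SeifertConcordanceGroup :=
  ⟨Quotient.map₂ SeifertForm.add fun _ _ h _ _ h' => Concordant.add h h'⟩

instance : Neg SeifertConcordanceGroup :=
  ⟨Quotient.map SeifertForm.neg fun _ _ h => Concordant.neg h⟩

theorem add_comm' (x y : SeifertConcordanceGroup) : x + y = y + x := by
  rcases x with ⟨S⟩
  rcases y with ⟨T⟩
  exact mk_eq_of_isometric (RatForm.isometric_comm S.form T.form)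

theorem add_zero' (x : SeifertConcordanceGroup) : x + 0 = x := by
  rcases x with ⟨S⟩
  exact mk_eq_of_isometric (S := S.add SeifertForm.zero) (RatForm.isometric_sum_zero S.form)

/-- Addition is the orthogonal sum, and the inverse is the change of sign. -/
instance : AddCommGroup SeifertConcordanceGroup where
  nsmul := nsmulRec
  zsmul := zsmulRec
  add_assoc := by
    rintro ⟨R⟩ ⟨S⟩ ⟨T⟩
    exact mk_eq_of_isometric (RatForm.isometric_assoc R.form S.form T.form)
  zero_add x := by rw [add_comm', add_zero']
  add_zero := add_zero'
  add_comm := add_comm'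
  neg_add_cancel := by
    rintro ⟨S⟩
    exact Quotient.sound (Concordant.neg_add S)

/-- The homomorphism induced by passing to `r` parallel copies. -/
def parallel (r : ℕ) : SeifertConcordanceGroup →+ SeifertConcordanceGroup :=
  AddMonoidHom.mk' (Quotient.map (SeifertForm.parallel r) fun _ _ h => Concordant.parallel h r) (by
    rintro ⟨S⟩ ⟨T⟩
    exact mk_eq_of_isometric (RatForm.isometric_parallel_sum r S.form T.form))

theorem parallel_one (x : SeifertConcordanceGroup) : parallel 1 x = x := by
  rcases x with ⟨S⟩
  exact mk_eq_of_isometric (RatForm.isometric_parallel_one S.form)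

theorem parallel_parallel (r s : ℕ) (x : SeifertConcordanceGroup) :
    parallel r (parallel s x) = parallel (s * r) x := by
  rcases x with ⟨S⟩
  exact mk_eq_of_isometric (RatForm.isometric_parallel_parallel r s S.form)

end SeifertConcordanceGroup

/-- Complexities: positive integers, ordered by divisibility. -/
structure Complexity where
  val : ℕ+
deriving DecidableEq

namespace Complexity

instance : Preorder Complexity where
  le c d := (c.val : ℕ) ∣ d.val
  le_refl _ := dvd_rfl
  le_trans _ _ _ h h' := h.trans h'

instance : IsDirectedOrder Complexity where
  directed c d := ⟨⟨c.val * d.val⟩, ⟨d.val, by simp⟩, ⟨c.val, by simp [mul_comm]⟩⟩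

/-- For `c ∣ d`, the map from complexity `c` to complexity `d` takes `d / c` parallel copies. -/
def map (c d : Complexity) (_ : c ≤ d) : SeifertConcordanceGroup →+ SeifertConcordanceGroup :=
  SeifertConcordanceGroup.parallel ((d.val : ℕ) / c.val)

instance : DirectedSystem (fun _ : Complexity => SeifertConcordanceGroup)
    fun c d h => map c d h where
  map_self c x := by
    rw [map, Nat.div_self c.val.pos, SeifertConcordanceGroup.parallel_one]
  map_map := by
    intro d c b hbc hcd x
    simp only [map]
    rw [SeifertConcordanceGroup.parallel_parallel, mul_comm]
    obtain ⟨k, hk⟩ := hbc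
    obtain ⟨l, hl⟩ := hcd
    rw [hl, hk, Nat.mul_div_cancel_left _ b.val.pos, mul_assoc,
      Nat.mul_div_cancel_left _ b.val.pos, ← mul_assoc,
      Nat.mul_div_cancel_left _ (by rw [← hk]; exact c.val.pos), mul_comm]

end Complexity

/-- The rational algebraic concordance group: the direct limit, over the complexities, of the
groups of concordance classes of rational Seifert forms. -/
abbrev RatAlgConcordanceGroup : Type 1 :=
  AddCommGroup.DirectLimit (fun _ : Complexity => SeifertConcordanceGroup) Complexity.map

/-- The class of a Seifert form of complexity one, i.e. of an ordinary Seifert surface of a knot in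
the three-sphere. -/
noncomputable def SeifertForm.ratClass (S : SeifertForm) : RatAlgConcordanceGroup :=
  AddCommGroup.DirectLimit.of (fun _ : Complexity => SeifertConcordanceGroup) Complexity.map ⟨1⟩
    (SeifertConcordanceGroup.mk S)

/-! ## Knot diagrams and their Seifert forms

A crossing of an oriented diagram is always viewed so that both strands run upwards. It has then
two incoming edges, the left one (from the south-west) and the right one (from the south-east), and
two outgoing edges, the left one (to the north-west) and the right one (to the north-east). -/

/-- The two sides of a crossing, seen along the direction of its strands. -/
inductive Side
  | left
  | right
deriving DecidableEq

namespace Side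

instance : Fintype Side := ⟨{left, right}, by rintro (_ | _) <;> decide⟩

/-- The other side. -/
def other : Side → Side
  | left => right
  | right => left

end Side

/-- The four corners of the complementary regions at a crossing: west, east, north, south. -/
inductive Corner
  | west
  | east
  | north
  | south
deriving DecidableEq

namespace Corner

/-- The corner to the left of the outgoing edge on the given side. -/
def leftOfOut : Side → Corner
  | .left => west
  | .right => north

/-- The corner to the right of the outgoing edge on the given side. -/
def rightOfOut : Side → Corner
  | .left => north
  | .right => east

/-- The corner to the left of the incoming edge on the given side. -/
def leftOfIn : Side → Corner
  | .left => west
  | .right => south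

/-- The corner to the right of the incoming edge on the given side. -/
def rightOfIn : Side → Corner
  | .left => south
  | .right => east

end Corner

namespace Diagram

variable {X : Type} (next : X × Side → X × Side)

/-- Follow a strand: an outgoing edge `e` enters the crossing `(next e).1` on the side `(next e).2`
and leaves it on the other side. -/
def strand (e : X × Side) : X × Side := ((next e).1, (next e).2.other)

/-- The components of the link. -/
def Component : Type := Quot fun e f : X × Side => strand next e = f

/-- Walking along an edge, the corner to its left at its start and the corner to its left at its end
lie in the same region, and so do the corners to its right. -/
inductive Adjacent : X × Corner → X × Corner → Prop
  | left (e : X × Side) :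
      Adjacent (e.1, Corner.leftOfOut e.2) ((next e).1, Corner.leftOfIn (next e).2)
  | right (e : X × Side) :
      Adjacent (e.1, Corner.rightOfOut e.2) ((next e).1, Corner.rightOfIn (next e).2)

/-- The complementary regions of the diagram. -/
def Region : Type := Quot (Adjacent next)

end Diagram

/-- An oriented knot diagram on the two-sphere with at least one crossing, as a combinatorial map. -/
structure KnotDiagram where
  /-- The set of crossings. -/
  X : Type
  [fintype : Fintype X]
  /-- A crossing is positive if the strand from the south-west to the north-east is the
  overstrand. -/
  positive : X → Bool
  /-- An edge of the diagram is given by the crossing that it leaves and the side on which it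
  leaves; `next` is the crossing at which the edge arrives and the side on which it arrives. -/
  next : X × Side → X × Side
  next_bijective : Function.Bijective next
  /-- The diagram has one component. -/
  knot : Nat.card (Diagram.Component next) = 1
  /-- The Euler characteristic of the surface that carries the diagram is two. -/
  planar : Nat.card (Diagram.Region next) = Fintype.card X + 2

namespace KnotDiagram

attribute [instance] KnotDiagram.fintype

variable (D : KnotDiagram)

/-- Seifert's algorithm smooths every crossing: the left incoming edge is joined to the left outgoing
edge and the right one to the right one. The resulting Seifert circles bound disjoint disks above
the projection sphere, and the Seifert surface `F` consists of these disks and of one half-twisted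
band for each crossing `v`, which joins the circle through the left side of `v` to the circle
through the right side. Let `Γ ⊂ F` be the graph that consists of the Seifert circles and of the
cores of the bands. A rational one-chain on `Γ` is a pair `(x, p)`, where `x v` is the coefficient of
the core of the band at `v`, oriented from left to right, and `p e` is the coefficient of the
edge `e`. It is a cycle if the following holds at each end of each band: on the left side of `v`
the incoming coefficient exceeds the outgoing one by `x v`, and on the right side it is the other way
round. -/
def cycles : Submodule ℚ ((D.X → ℚ) × (D.X × Side → ℚ)) where
  carrier := {a | ∀ e, a.2 (D.next e) = match D.next e with
    | (v, .left) => a.2 e - a.1 v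
    | (v, .right) => a.2 e + a.1 v}
  zero_mem' e := by
    rcases D.next e with ⟨v, _ | _⟩ <;> simp
  add_mem' := by
    intro a b ha hb e
    have ha := ha e
    have hb := hb e
    revert ha hb
    rcases D.next e with ⟨v, _ | _⟩ <;> intro ha hb <;> simp at ha hb ⊢ <;> rw [ha, hb] <;> ring
  smul_mem' := by
    intro c a ha e
    have ha := ha e
    revert ha
    rcases D.next e with ⟨v, _ | _⟩ <;> intro ha <;> simp at ha ⊢ <;> rw [ha] <;> ring

/-- The linking number of the cycle `a` with the push-off of the cycle `b` in the positive normal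
direction of `F`, computed as the signed number of passages of the push-off of `b` over `a`. The
push-off moves the Seifert circles to their right, so in the projection (after a small isotopy
near the bands) the only such passages are at the left ends of the bands: there
the band core of `a` at `v` passes, from left to right, under the edge of the overstrand of `v` that
lies on the left side of `v`. Each passage counts `-1`. This edge is the incoming one if `v` is
positive, in which case the coefficient of `b` on it is `b.2 (v, left) + b.1 v`, and it is the outgoing
one if `v` is negative, in which case the coefficient is `b.2 (v, left)`. -/
def linking (a b : (D.X → ℚ) × (D.X × Side → ℚ)) : ℚ :=
  -∑ v, a.1 v * (b.2 (v, Side.left) + if D.positive v then b.1 v else 0)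

/-- `S` is the Seifert form of the Seifert surface `F` of `D`: the space of `S` is the homology
`H₁(F; ℚ)`, i.e. the space of cycles on `Γ` modulo the Seifert circles (which bound disks in `F`, and
which span the cycles with vanishing coefficients on the bands), and the form of `S` is the linking
number with the push-off. -/
def IsSeifertForm (S : SeifertForm) : Prop :=
  ∃ π : D.cycles →ₗ[ℚ] S.V, Function.Surjective π ∧ (∀ a, π a = 0 ↔ a.1.1 = 0) ∧
    ∀ a b, S.form (π a) (π b) = D.linking a.1 b.1

/-- A knot is algebraically rationally slice if the class of its Seifert form in the rational
algebraic concordance group is zero. The form `S` is unique up to isometry. -/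
def IsAlgRatSlice : Prop :=
  ∃ S : SeifertForm, D.IsSeifertForm S ∧ S.ratClass = 0

end KnotDiagram

/-! ## Twist knots -/

namespace TwistKnot

/-- The edges of the standard diagram of the twist knot with `N` full twists, of either sign. The
crossings `0` and `1` form the clasp, and the crossings `2, …, 2 * N + 1` form the row of `2 * N` half
twists. The strands of the clasp and the strands of the row are antiparallel: `0` and `1` are stacked
vertically, `0` below `1`, with both strands of `0` pointing east and both strands of `1` pointing
west; the row is horizontal, to the right of the clasp, and its strands point north at the even and
south at the odd crossings. The four ends of the row are joined to the four ends of the clasp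
without further crossings. -/
def nextNat (N : ℕ) : ℕ × Side → ℕ × Side
  | (i, .left) =>
    if i = 0 then (1, .left)
    else if i = 1 then (0, .left)
    else if i % 2 = 0 then
      if i = 2 then (1, .right) else (i - 1, .left)
    else
      if i = 2 * N + 1 then (0, .right) else (i + 1, .left)
  | (i, .right) =>
    if i = 0 then
      if N = 0 then (0, .right) else (2, .left)
    else if i = 1 then
      if N = 0 then (1, .right) else (2 * N + 1, .left)
    else if i % 2 = 0 then (i + 1, .right)
    else (i - 1, .right)

theorem nextNat_lt (N : ℕ) (i : ℕ) (hi : i < 2 * N + 2) (s : Side) :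
    (nextNat N (i, s)).1 < 2 * N + 2 := by
  rcases s with _ | _ <;> simp only [nextNat] <;> split_ifs <;> simp <;> omega

/-- The edges of the diagram, on the set of crossings. -/
def next (N : ℕ) (e : Fin (2 * N + 2) × Side) : Fin (2 * N + 2) × Side :=
  (⟨(nextNat N (e.1, e.2)).1, nextNat_lt N e.1 e.1.2 e.2⟩, (nextNat N (e.1, e.2)).2)

theorem next_eq (N : ℕ) (i : ℕ) (hi : i < 2 * N + 2) (s : Side) (j : ℕ) (hj : j < 2 * N + 2)
    (t : Side) (h : nextNat N (i, s) = (j, t)) : next N (⟨i, hi⟩, s) = (⟨j, hj⟩, t) := by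
  simp [next, h]

theorem next_bijective (N : ℕ) : Function.Bijective (next N) := by
  rw [← Finite.injective_iff_bijective]
  rintro ⟨⟨i, hi⟩, s⟩ ⟨⟨j, hj⟩, t⟩ h
  have h1 : (nextNat N (i, s)).1 = (nextNat N (j, t)).1 := congrArg (fun e => (e.1 : ℕ)) h
  have h2 : (nextNat N (i, s)).2 = (nextNat N (j, t)).2 := congrArg (fun e => e.2) h
  rcases s with _ | _ <;> rcases t with _ | _ <;> simp only [nextNat] at h1 h2 <;>
    split_ifs at h1 h2 <;> simp at h1 h2 ⊢ <;> omega

section Component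

variable (N : ℕ)

/-- The component of an edge. -/
def comp (i : ℕ) (hi : i < 2 * N + 2) (s : Side) : Diagram.Component (next N) :=
  Quot.mk _ (⟨i, hi⟩, s)

theorem comp_eq (i : ℕ) (hi : i < 2 * N + 2) (s : Side) (j : ℕ) (hj : j < 2 * N + 2) (t : Side)
    (h : nextNat N (i, s) = (j, t)) : comp N i hi s = comp N j hj t.other := by
  refine Quot.sound ?_
  rw [Diagram.strand, next_eq N i hi s j hj t h]

theorem comp_aux (i : ℕ) (h2 : 2 ≤ i) (hi : i < 2 * N + 2) :
    comp N i hi .left = comp N 1 (by omega) .left ∧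
      comp N i hi .right = comp N 1 (by omega) .left := by
  induction i, h2 using Nat.le_induction with
  | base =>
    have a1 : comp N 1 (by omega) .left = comp N 0 (by omega) .right :=
      comp_eq N 1 _ _ 0 (by omega) .left (by simp [nextNat])
    have a2 : comp N 2 (by omega) .left = comp N 1 (by omega) .left :=
      comp_eq N 2 _ _ 1 (by omega) .right (by simp [nextNat])
    have a3 : comp N 0 (by omega) .right = comp N 2 (by omega) .right :=
      comp_eq N 0 _ _ 2 (by omega) .left (by simp [nextNat]; omega)
    exact ⟨a2, a3.symm.trans a1.symm⟩
  | succ i h2 ih =>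
    obtain ⟨hl, hr⟩ := ih (by omega)
    rcases Nat.mod_two_eq_zero_or_one i with h | h
    · have b1 : comp N i (by omega) .right = comp N (i + 1) hi .left :=
        comp_eq N i _ _ (i + 1) hi .right (by simp [nextNat]; grind)
      have b2 : comp N (i + 1) hi .right = comp N i (by omega) .left :=
        comp_eq N (i + 1) _ _ i (by omega) .right (by simp [nextNat]; grind)
      exact ⟨b1.symm.trans hr, b2.trans hl⟩
    · have b1 : comp N i (by omega) .left = comp N (i + 1) hi .right :=
        comp_eq N i _ _ (i + 1) hi .left (by simp [nextNat]; grind)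
      have b2 : comp N (i + 1) hi .left = comp N i (by omega) .right :=
        comp_eq N (i + 1) _ _ i (by omega) .left (by simp [nextNat]; grind)
      exact ⟨b2.trans hr, b1.symm.trans hl⟩

theorem card_component : Nat.card (Diagram.Component (next N)) = 1 := by
  have a1 : comp N 1 (by omega) .left = comp N 0 (by omega) .right :=
    comp_eq N 1 _ _ 0 (by omega) .left (by simp [nextNat])
  have a0 : comp N 0 (by omega) .left = comp N 1 (by omega) .right :=
    comp_eq N 0 _ _ 1 (by omega) .left (by simp [nextNat])
  have a2 : comp N 1 (by omega) .right = comp N 1 (by omega) .left := by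
    rcases Nat.eq_zero_or_pos N with h | h
    · exact comp_eq N 1 _ _ 1 (by omega) .right (by simp [nextNat, h])
    · exact (comp_eq N 1 _ _ (2 * N + 1) (by omega) .left (by simp [nextNat]; omega)).trans
        (comp_aux N (2 * N + 1) (by omega) (by omega)).2
  rw [Nat.card_eq_one_iff_unique]
  refine ⟨⟨?_⟩, ⟨comp N 0 (by omega) .left⟩⟩
  have key : ∀ c : Diagram.Component (next N), c = comp N 1 (by omega) .left := by
    rintro ⟨⟨⟨i, hi⟩, s⟩⟩
    change comp N i hi s = _
    rcases Nat.lt_or_ge i 2 with h | h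
    · interval_cases i <;> rcases s with _ | _
      · exact a0.trans a2
      · exact a1.symm
      · rfl
      · exact a2
    · rcases s with _ | _
      · exact (comp_aux N i h hi).1
      · exact (comp_aux N i h hi).2
  intro c d
  rw [key c, key d]

end Component

section Region

variable (N : ℕ)

/-- A numbering of the regions: `0` is the bigon of the clasp, `1, …, 2 * N + 1` are the regions between
consecutive crossings of the row, from left to right, starting and ending with the regions that
separate the row from the clasp, `2 * N + 2` lies below the row and `2 * N + 3` above it. -/
def label (i : ℕ) : Corner → ℕ
  | .west => if i ≤ 1 then 0 else if i % 2 = 0 then i - 1 else i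
  | .east => if i = 0 then 2 * N + 2 else if i = 1 then 2 * N + 3
      else if i % 2 = 0 then i else i - 1
  | .north => if i = 0 then 1 else if i = 1 then 2 * N + 1
      else if i % 2 = 0 then 2 * N + 3 else 2 * N + 2
  | .south => if i = 0 then 2 * N + 1 else if i = 1 then 1
      else if i % 2 = 0 then 2 * N + 2 else 2 * N + 3

theorem label_lt (i : ℕ) (hi : i < 2 * N + 2) (c : Corner) : label N i c < 2 * N + 4 := by
  rcases c with _ | _ | _ | _ <;> simp only [label] <;> split_ifs <;> omega

/-- The region of a corner. -/
def reg (i : ℕ) (hi : i < 2 * N + 2) (c : Corner) : Diagram.Region (next N) :=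
  Quot.mk _ (⟨i, hi⟩, c)

theorem reg_eq (i : ℕ) (hi : i < 2 * N + 2) (s : Side) (j : ℕ) (hj : j < 2 * N + 2) (t : Side)
    (h : nextNat N (i, s) = (j, t)) :
    reg N i hi (Corner.leftOfOut s) = reg N j hj (Corner.leftOfIn t) ∧
      reg N i hi (Corner.rightOfOut s) = reg N j hj (Corner.rightOfIn t) := by
  have hl := Quot.sound (Diagram.Adjacent.left (next := next N) (⟨i, hi⟩, s))
  have hr := Quot.sound (Diagram.Adjacent.right (next := next N) (⟨i, hi⟩, s))
  rw [next_eq N i hi s j hj t h] at hl hr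
  exact ⟨hl, hr⟩

theorem label_eq (i : ℕ) (hi : i < 2 * N + 2) (s : Side) (j : ℕ) (t : Side)
    (h : nextNat N (i, s) = (j, t)) :
    label N i (Corner.leftOfOut s) = label N j (Corner.leftOfIn t) ∧
      label N i (Corner.rightOfOut s) = label N j (Corner.rightOfIn t) := by
  rcases s with _ | _ <;> rcases t with _ | _ <;> simp only [nextNat] at h <;> split_ifs at h <;>
    simp only [Prod.mk.injEq, reduceCtorEq, and_false, and_true] at h <;> subst h <;>
    simp only [label, Corner.leftOfOut, Corner.rightOfOut, Corner.leftOfIn, Corner.rightOfIn] <;>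
    constructor <;> split_ifs <;> first | contradiction | omega

/-- The number of a region. -/
def regLabel : Diagram.Region (next N) → Fin (2 * N + 4) :=
  Quot.lift (fun a => ⟨label N a.1 a.2, label_lt N a.1 a.1.2 a.2⟩) (by
    rintro _ _ (⟨⟨⟨i, hi⟩, s⟩⟩ | ⟨⟨⟨i, hi⟩, s⟩⟩)
    · exact Fin.ext (label_eq N i hi s _ _ rfl).1
    · exact Fin.ext (label_eq N i hi s _ _ rfl).2)

theorem row_aux (i : ℕ) (h2 : 2 ≤ i) (hi : i < 2 * N + 2) :
    reg N i hi (if i % 2 = 0 then .north else .south) = reg N 1 (by omega) .east ∧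
      reg N i hi (if i % 2 = 0 then .south else .north) = reg N 0 (by omega) .east := by
  induction i, h2 using Nat.le_induction with
  | base =>
    have a := reg_eq N 2 hi .left 1 (by omega) .right (by simp [nextNat])
    have b := reg_eq N 0 (by omega) .right 2 hi .left (by simp [nextNat]; omega)
    exact ⟨a.2, b.2.symm⟩
  | succ i h2 ih =>
    obtain ⟨hl, hr⟩ := ih (by omega)
    rcases Nat.mod_two_eq_zero_or_one i with h | h
    · have a := reg_eq N i (by omega) .right (i + 1) hi .right (by simp [nextNat]; grind)
      have b := reg_eq N (i + 1) hi .right i (by omega) .right (by simp [nextNat]; grind)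
      rw [if_pos h] at hl hr
      rw [if_neg (by omega), if_neg (by omega)]
      exact ⟨a.1.symm.trans hl, b.1.trans hr⟩
    · have a := reg_eq N i (by omega) .left (i + 1) hi .left (by simp [nextNat]; grind)
      have b := reg_eq N (i + 1) hi .left i (by omega) .left (by simp [nextNat]; grind)
      rw [if_neg (by omega)] at hl hr
      rw [if_pos (by omega), if_pos (by omega)]
      exact ⟨b.2.trans hl, a.2.symm.trans hr⟩

/-- A corner of the region with a given number. -/
def rep (g : ℕ) : Diagram.Region (next N) :=
  if g = 0 then reg N 0 (by omega) .west
  else if g = 1 then reg N 0 (by omega) .north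
  else if g = 2 * N + 2 then reg N 0 (by omega) .east
  else if g = 2 * N + 3 then reg N 1 (by omega) .east
  else if h : g < 2 * N + 2 then reg N g h (if g % 2 = 0 then .east else .west)
  else reg N 0 (by omega) .west

theorem reg_eq_rep (i : ℕ) (hi : i < 2 * N + 2) (c : Corner) : reg N i hi c = rep N (label N i c) := by
  have c0 := reg_eq N 0 (by omega) .left 1 (by omega) .left (by simp [nextNat])
  have c1 := reg_eq N 1 (by omega) .left 0 (by omega) .left (by simp [nextNat])
  have outer : reg N 0 (by omega) .south = rep N (2 * N + 1) := by
    rcases Nat.eq_zero_or_pos N with h | h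
    · subst h
      exact (reg_eq 0 0 (by omega) .right 0 (by omega) .right (by simp [nextNat])).1.symm
    · have a := reg_eq N (2 * N + 1) (by omega) .left 0 (by omega) .right
        (by simp [nextNat]; omega)
      rw [rep, if_neg (by omega), if_neg (by omega), if_neg (by omega), if_neg (by omega),
        dif_pos (by omega), if_neg (by omega)]
      exact a.1.symm
  rcases Nat.lt_or_ge i 2 with h | h
  · interval_cases i <;> rcases c with _ | _ | _ | _
    · simp [label, rep]
    · simp [label, rep]
    · simp [label, rep]
    · exact outer
    · exact c0.1.symm
    · simp [label, rep]
    · exact c1.2.trans outer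
    · exact c0.2.symm
  · obtain ⟨ht, hb⟩ := row_aux N i h hi
    have two : reg N 2 (by omega) .west = reg N 0 (by omega) .north :=
      (reg_eq N 0 (by omega) .right 2 (by omega) .left (by simp [nextNat]; omega)).1.symm
    rcases Nat.mod_two_eq_zero_or_one i with h' | h'
    · rw [if_pos h'] at ht hb
      rcases c with _ | _ | _ | _
      · rcases Nat.lt_or_ge i 3 with h3 | h3
        · obtain rfl : i = 2 := by omega
          simpa [label, rep] using two
        · have a := (reg_eq N i hi .left (i - 1) (by omega) .left (by simp [nextNat]; grind)).1
          have e : label N i .west = i - 1 := by simp only [label]; split_ifs <;> omega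
          rw [e, rep, if_neg (by omega), if_neg (by omega), if_neg (by omega), if_neg (by omega),
            dif_pos (by omega), if_neg (by omega)]
          exact a
      · have e : label N i .east = i := by simp only [label]; split_ifs <;> omega
        rw [e, rep, if_neg (by omega), if_neg (by omega), if_neg (by omega), if_neg (by omega),
            dif_pos (by omega), if_pos (by omega)]
      · have e : label N i .north = 2 * N + 3 := by simp only [label]; split_ifs <;> omega
        rw [e, ht]
        simp [rep]
      · have e : label N i .south = 2 * N + 2 := by simp only [label]; split_ifs <;> omega
        rw [e, hb]
        simp [rep]
    · rw [if_neg (by omega)] at ht hb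
      rcases c with _ | _ | _ | _
      · have e : label N i .west = i := by simp only [label]; split_ifs <;> omega
        rw [e, rep, if_neg (by omega), if_neg (by omega), if_neg (by omega), if_neg (by omega),
            dif_pos (by omega), if_neg (by omega)]
      · have a := (reg_eq N i hi .right (i - 1) (by omega) .right (by simp [nextNat]; grind)).2
        have e : label N i .east = i - 1 := by simp only [label]; split_ifs <;> omega
        rw [e, rep, if_neg (by omega), if_neg (by omega), if_neg (by omega), if_neg (by omega),
          dif_pos (by omega), if_pos (by omega)]
        exact a
      · have e : label N i .north = 2 * N + 2 := by simp only [label]; split_ifs <;> omega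
        rw [e, hb]
        simp [rep]
      · have e : label N i .south = 2 * N + 3 := by simp only [label]; split_ifs <;> omega
        rw [e, ht]
        simp [rep]

theorem card_region : Nat.card (Diagram.Region (next N)) = 2 * N + 4 := by
  have hl : ∀ a, rep N (regLabel N a) = a := by
    rintro ⟨⟨⟨i, hi⟩, c⟩⟩
    exact (reg_eq_rep N i hi c).symm
  have hr : ∀ g : Fin (2 * N + 4), regLabel N (rep N g) = g := by
    rintro ⟨g, hg⟩
    have hreg : ∀ i hi c, (regLabel N (reg N i hi c) : ℕ) = label N i c := fun _ _ _ => rfl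
    refine Fin.ext ?_
    simp only [rep]
    split_ifs <;> rw [hreg] <;> simp only [label] <;> split_ifs <;> first | contradiction | omega
  rw [Nat.card_congr (⟨regLabel N, fun g => rep N g, hl, hr⟩ : _ ≃ Fin (2 * N + 4)),
    Nat.card_eq_fintype_card, Fintype.card_fin]

end Region

end TwistKnot

/-- The twist knot `K n` with `n` full twists: the clasp consists of two positive crossings, and the `n`
full twists, of antiparallel strands, consist of `2 * |n|` crossings which are negative if `n > 0` and
positive if `n < 0`. Thus `K 0` is the unknot, `K 1` the figure-eight knot, `K 2` the stevedore knot,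
and `K (-1)` the right-handed trefoil. -/
def twistKnot (n : ℤ) : KnotDiagram where
  X := Fin (2 * n.natAbs + 2)
  positive v := decide ((v : ℕ) < 2 ∨ n < 0)
  next := TwistKnot.next n.natAbs
  next_bijective := TwistKnot.next_bijective n.natAbs
  knot := TwistKnot.card_component n.natAbs
  planar := by rw [TwistKnot.card_region, Fintype.card_fin]

/-! ## Vanishing in the direct limit -/

namespace SeifertForm

/-! The class of a form vanishes in the direct limit exactly when `r` parallel copies of it are
metabolic for some `r > 0` (`ratClass_eq_zero_iff`). For `n ≠ 0` the diagram has the Seifert form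
`twistBilin n` on `ℚ²` (`linking_eq`), so the question is when some `parallel r (twistBilin n)` is
metabolic. For `n = 0` the Seifert surface is a disk.

A nondegenerate form `B` has a monodromy `T` with `B x y = B y (T x)`. For `r` copies it is a cyclic
shift of the copies whose `r`-th power is the original monodromy. It has a cyclic vector, and its
characteristic polynomial is, up to a constant, `Δ(X ^ r)` with `Δ = n X² - (2n+1) X + n`. A
metabolizer is `T`-invariant, hence it is given by a polynomial `f` of half the degree, and the
vanishing of `B` on it makes `Δ(X ^ r)` a constant multiple of `f.reverse * f` (`exists_norm`). A
root of such a product that has the same minimal polynomial as its inverse is a double root, whereas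
`Δ(X ^ r)` has only simple roots because the discriminant `4n+1` of `Δ` is nonzero. So one root
conjugate to its inverse is an obstruction for that `r` (`not_metabolic_of_conjugate`).

For `n < 0` the roots lie on the unit circle and complex conjugation inverts them. For `n > 0`, with
neither `n` nor `4n+1` a square, a positive root `β` serves (`aeval_inv_minpoly`). Otherwise its
minimal polynomial `h` would have `β` as its only positive root, hence `h(0) < 0`; its degree is
even, so there is a negative root, which is `-β` or `-β⁻¹`. In the first case `h` is a polynomial in
`X²` and induction on `r` applies to `β²`. In the second `h` is antisymmetric under `x ↦ -x⁻¹` and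
its degree is divisible by four, so `h(i) = 0`; but `i ^ r` is never a root of `Δ`.

Conversely, `4n+1` is a square exactly when `n = k(k-1)`, and then `twistBilin n` is itself
metabolic. If `n = k²`, then `Δ(X²) = (kX² - X - k)(kX² + X - k)`, and the factors yield a
metabolizer for two copies. -/

theorem mk_eq_zero_iff (S : SeifertForm) :
    SeifertConcordanceGroup.mk S = 0 ↔ RatForm.Metabolic S.form := by
  constructor
  · intro h
    have h : Concordant S zero := Quotient.exact h
    exact RatForm.Metabolic.of_equiv (C := S.form)
      (LinearEquiv.prodUnique (R := ℚ) (M := S.V) (M₂ := PUnit.{1})) (fun x y => by simp) h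
  · intro h
    refine Quotient.sound (s := SeifertForm.setoid) ?_
    exact RatForm.Metabolic.of_equiv (C := RatForm.sum S.form (-zero.form))
      (LinearEquiv.prodUnique (R := ℚ) (M := S.V) (M₂ := PUnit.{1})).symm (fun x y => by simp) h

theorem ratClass_eq_zero_iff (S : SeifertForm) :
    S.ratClass = 0 ↔ ∃ r : ℕ, 0 < r ∧ RatForm.Metabolic (RatForm.parallel r S.form) := by
  constructor
  · intro h
    -- An element dies in a direct limit only if it dies at some stage `c`; the transition map from
    -- complexity one takes `c / 1` copies.
    obtain ⟨c, hc, h⟩ := AddCommGroup.DirectLimit.of.zero_exact _ _ h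
    refine ⟨c.val, c.val.pos, ?_⟩
    have h : SeifertConcordanceGroup.parallel ((c.val : ℕ) / ((1 : ℕ+) : ℕ))
        (SeifertConcordanceGroup.mk S) = 0 := h
    rw [PNat.one_coe, Nat.div_one] at h
    exact (mk_eq_zero_iff (S.parallel c.val)).1 h
  · rintro ⟨r, hr, h⟩
    let c : Complexity := ⟨⟨r, hr⟩⟩
    have hc : (⟨1⟩ : Complexity) ≤ c := one_dvd _
    have h0 : Complexity.map ⟨1⟩ c hc (SeifertConcordanceGroup.mk S) = 0 := by
      change SeifertConcordanceGroup.parallel (r / ((1 : ℕ+) : ℕ))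
        (SeifertConcordanceGroup.mk S) = 0
      rw [PNat.one_coe, Nat.div_one]
      exact (mk_eq_zero_iff (S.parallel r)).2 h
    rw [ratClass, ← AddCommGroup.DirectLimit.of_f hc, h0, map_zero]

theorem ratClass_eq_of_isometric {S T : SeifertForm} (h : RatForm.Isometric S.form T.form) :
    S.ratClass = T.ratClass := by
  rw [ratClass, ratClass, SeifertConcordanceGroup.mk_eq_of_isometric h]

end SeifertForm

/-! ## Seifert forms of the standard diagrams of twist knots -/

namespace KnotDiagram

variable {D : KnotDiagram}

/-- The Seifert form of a diagram is unique up to isometry. -/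
theorem IsSeifertForm.isometric {S T : SeifertForm} (hS : D.IsSeifertForm S)
    (hT : D.IsSeifertForm T) : RatForm.Isometric S.form T.form := by
  obtain ⟨π, hπ, hπ0, hπl⟩ := hS
  obtain ⟨ρ, hρ, hρ0, hρl⟩ := hT
  have hker : LinearMap.ker π = LinearMap.ker ρ := by
    ext a
    rw [LinearMap.mem_ker, LinearMap.mem_ker, hπ0, hρ0]
  let e := (π.quotKerEquivOfSurjective hπ).symm.trans
    ((Submodule.quotEquivOfEq _ _ hker).trans (ρ.quotKerEquivOfSurjective hρ))
  have he : ∀ a, e (π a) = ρ a := by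
    intro a
    have : (π.quotKerEquivOfSurjective hπ).symm (π a) = Submodule.Quotient.mk a := by
      rw [LinearEquiv.symm_apply_eq]
      rfl
    simp only [e, LinearEquiv.trans_apply, this]
    rfl
  refine ⟨e, fun x y => ?_⟩
  obtain ⟨a, rfl⟩ := hπ x
  obtain ⟨b, rfl⟩ := hπ y
  rw [he, he, hπl, hρl]

theorem isAlgRatSlice_iff {S : SeifertForm} (hS : D.IsSeifertForm S) :
    D.IsAlgRatSlice ↔ ∃ r : ℕ, 0 < r ∧ RatForm.Metabolic (RatForm.parallel r S.form) := by
  rw [← SeifertForm.ratClass_eq_zero_iff]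
  constructor
  · rintro ⟨T, hT, h⟩
    rw [SeifertForm.ratClass_eq_of_isometric (hS.isometric hT), h]
  · exact fun h => ⟨S, hS, h⟩

theorem cycles_left {a : (D.X → ℚ) × (D.X × Side → ℚ)} (ha : a ∈ D.cycles) {e : D.X × Side}
    {v : D.X} (h : D.next e = (v, .left)) : a.2 (v, .left) = a.2 e - a.1 v := by
  have := ha e
  rwa [h] at this

theorem cycles_right {a : (D.X → ℚ) × (D.X × Side → ℚ)} (ha : a ∈ D.cycles) {e : D.X × Side}
    {v : D.X} (h : D.next e = (v, .right)) : a.2 (v, .right) = a.2 e + a.1 v := by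
  have := ha e
  rwa [h] at this

end KnotDiagram

/-- The bilinear form on `ℚ²` with the matrix `!![-1, 0; -1, n]`. -/
def twistBilin (n : ℤ) : ℚ × ℚ →ₗ[ℚ] ℚ × ℚ →ₗ[ℚ] ℚ :=
  LinearMap.mk₂ ℚ (fun u w => -(u.1 * w.1) - u.2 * w.1 + n * (u.2 * w.2))
    (fun u u' w => by simp; ring) (fun c u w => by simp; ring)
    (fun u w w' => by simp; ring) (fun c u w => by simp; ring)

theorem twistBilin_apply (n : ℤ) (u w : ℚ × ℚ) :
    twistBilin n u w = -(u.1 * w.1) - u.2 * w.1 + n * (u.2 * w.2) := rfl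

theorem twistBilin_nonsing (n : ℤ) : RatForm.Nonsing (twistBilin n) := by
  intro u hu
  have h1 := hu (1, 0)
  have h2 := hu (0, 1)
  simp only [twistBilin_apply] at h1 h2
  exact Prod.ext (by simp; linarith) (by simp; linarith)

/-- The Seifert form of the genus one Seifert surface of a twist knot. -/
def twistForm (n : ℤ) : SeifertForm where
  V := ℚ × ℚ
  form := twistBilin n
  nonsing := twistBilin_nonsing n

namespace TwistKnot

variable {n : ℤ}

/-- The band coefficients of a chain, as a sequence. -/
def band (a : ((twistKnot n).X → ℚ) × ((twistKnot n).X × Side → ℚ)) (i : ℕ) : ℚ :=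
  if h : i < 2 * n.natAbs + 2 then a.1 (⟨i, h⟩ : Fin _) else 0

/-- The coefficients of a chain on the edges that leave the crossings on a given side, as a
sequence. -/
def edge (a : ((twistKnot n).X → ℚ) × ((twistKnot n).X × Side → ℚ)) (s : Side) (i : ℕ) : ℚ :=
  if h : i < 2 * n.natAbs + 2 then a.2 ((⟨i, h⟩ : Fin _), s) else 0

theorem edge_left {a : ((twistKnot n).X → ℚ) × ((twistKnot n).X × Side → ℚ)}
    (ha : a ∈ (twistKnot n).cycles) {i j : ℕ} {s : Side} (hi : i < 2 * n.natAbs + 2)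
    (hj : j < 2 * n.natAbs + 2) (h : nextNat n.natAbs (i, s) = (j, .left)) :
    edge a .left j = edge a s i - band a j := by
  rw [edge, edge, band, dif_pos hi, dif_pos hj, dif_pos hj]
  exact KnotDiagram.cycles_left ha (next_eq _ i hi s j hj _ h)

theorem edge_right {a : ((twistKnot n).X → ℚ) × ((twistKnot n).X × Side → ℚ)}
    (ha : a ∈ (twistKnot n).cycles) {i j : ℕ} {s : Side} (hi : i < 2 * n.natAbs + 2)
    (hj : j < 2 * n.natAbs + 2) (h : nextNat n.natAbs (i, s) = (j, .right)) :
    edge a .right j = edge a s i + band a j := by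
  rw [edge, edge, band, dif_pos hi, dif_pos hj, dif_pos hj]
  exact KnotDiagram.cycles_right ha (next_eq _ i hi s j hj _ h)

theorem edge_clasp {a : ((twistKnot n).X → ℚ) × ((twistKnot n).X × Side → ℚ)}
    (ha : a ∈ (twistKnot n).cycles) : edge a .left 1 = edge a .left 0 - band a 1 :=
  edge_left ha (by omega) (by omega) (by simp [nextNat])

/-- The left sides of the two clasp crossings form one Seifert circle, which meets no other band, so
the flows through its two bands cancel. -/
theorem band_clasp {a : ((twistKnot n).X → ℚ) × ((twistKnot n).X × Side → ℚ)}
    (ha : a ∈ (twistKnot n).cycles) : band a 1 = -band a 0 := by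
  have h : edge a .left 0 = edge a .left 1 - band a 0 :=
    edge_left ha (by omega) (by omega) (by simp [nextNat])
  linarith [edge_clasp ha]

theorem edge_row_left {a : ((twistKnot n).X → ℚ) × ((twistKnot n).X × Side → ℚ)}
    (ha : a ∈ (twistKnot n).cycles) {i : ℕ} (h2 : 2 ≤ i) (hi : i + 1 < 2 * n.natAbs + 2)
    (h : i % 2 = 1) : edge a .left (i + 1) = edge a .left i - band a (i + 1) :=
  edge_left ha (by omega) hi (by simp [nextNat]; grind)

/-- Neighbouring crossings of the row share a Seifert circle that meets only their two bands:
through the right sides if `i` is even, through the left sides if `i` is odd. -/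
theorem band_row_succ {a : ((twistKnot n).X → ℚ) × ((twistKnot n).X × Side → ℚ)}
    (ha : a ∈ (twistKnot n).cycles) {i : ℕ} (h2 : 2 ≤ i) (hi : i + 1 < 2 * n.natAbs + 2) :
    band a (i + 1) = -band a i := by
  rcases Nat.mod_two_eq_zero_or_one i with h | h
  · have h1 : edge a .right (i + 1) = edge a .right i + band a (i + 1) :=
      edge_right ha (by omega) hi (by simp [nextNat]; grind)
    have h2 : edge a .right i = edge a .right (i + 1) + band a i :=
      edge_right ha hi (by omega) (by simp [nextNat]; grind)
    linarith
  · have h1 := edge_row_left ha h2 hi h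
    have h2 : edge a .left i = edge a .left (i + 1) - band a i :=
      edge_left ha hi (by omega) (by simp [nextNat]; grind)
    linarith

theorem band_row {a : ((twistKnot n).X → ℚ) × ((twistKnot n).X × Side → ℚ)}
    (ha : a ∈ (twistKnot n).cycles) {i : ℕ} (hi : i + 2 < 2 * n.natAbs + 2) :
    band a (i + 2) = (-1) ^ i * band a 2 := by
  induction i with
  | zero => simp
  | succ i ih =>
    have := band_row_succ ha (i := i + 2) (by omega) (by omega)
    rw [show i + 1 + 2 = i + 2 + 1 by ring, this, ih (by omega), pow_succ]
    ring

/-- The outer Seifert circle. -/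
theorem edge_row_last {a : ((twistKnot n).X → ℚ) × ((twistKnot n).X × Side → ℚ)}
    (ha : a ∈ (twistKnot n).cycles) (hn : n ≠ 0) :
    edge a .left (2 * n.natAbs + 1) = edge a .left 2 - band a 0 + band a 2 := by
  have hN : 0 < n.natAbs := Int.natAbs_pos.2 hn
  -- The outer circle runs through the crossings `2`, `1`, `2 * N + 1`, `0` in this order, where `N
  -- = |n|`; its arc from `2` to `2 * N + 1` is used.
  have h1 : edge a .right 1 = edge a .left 2 + band a 1 :=
    edge_right ha (by omega) (by omega) (by simp [nextNat])
  have h2 : edge a .left (2 * n.natAbs + 1) = edge a .right 1 - band a (2 * n.natAbs + 1) :=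
    edge_left ha (by omega) (by omega) (by simp [nextNat]; omega)
  have h3 := band_row ha (i := 2 * n.natAbs - 1) (by omega)
  rw [show 2 * n.natAbs - 1 + 2 = 2 * n.natAbs + 1 by omega,
    Odd.neg_one_pow (by rw [Nat.odd_iff]; omega)] at h3
  have := band_clasp ha
  linarith

/-- After the first term the summands pair up along the small left circles, and each pair
contributes `-band a 2`. The number of terms is odd because the last crossing of the row has its
left side on the outer circle instead. -/
theorem sum_edge_row {a : ((twistKnot n).X → ℚ) × ((twistKnot n).X × Side → ℚ)}
    (ha : a ∈ (twistKnot n).cycles) {k : ℕ} (hk : k < n.natAbs) :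
    ∑ i ∈ Finset.range (2 * k + 1), (-1) ^ i * edge a .left (i + 2) =
      edge a .left 2 - k * band a 2 := by
  induction k with
  | zero => simp
  | succ k ih =>
    have h1 := edge_row_left ha (i := 2 * k + 3) (by omega) (by omega) (by omega)
    have h2 := band_row ha (i := 2 * k + 2) (by omega)
    rw [Even.neg_one_pow (by rw [Nat.even_iff]; omega)] at h2
    rw [show 2 * (k + 1) + 1 = 2 * k + 1 + 1 + 1 by ring, Finset.sum_range_succ,
      Finset.sum_range_succ, ih (by omega), Odd.neg_one_pow (by rw [Nat.odd_iff]; omega),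
      Even.neg_one_pow (by rw [Nat.even_iff]; omega), show 2 * k + 1 + 1 + 2 = 2 * k + 3 + 1 by ring,
      h1, show 2 * k + 3 + 1 = 2 * k + 2 + 2 by ring, h2]
    push_cast
    ring

/-- Band coefficients alternate along the clasp and along the row, so only differences of edge
coefficients within a Seifert circle enter, and these are band coefficients. -/
theorem linking_eq {a b : ((twistKnot n).X → ℚ) × ((twistKnot n).X × Side → ℚ)} (hn : n ≠ 0)
    (ha : a ∈ (twistKnot n).cycles) (hb : b ∈ (twistKnot n).cycles) :
    (twistKnot n).linking a b = twistBilin n (band a 0, band a 2) (band b 0, band b 2) := by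
  have hN : 0 < n.natAbs := Int.natAbs_pos.2 hn
  have h0 : (twistKnot n).linking a b = -∑ i ∈ Finset.range (2 * n.natAbs + 2),
      band a i * (edge b .left i + if i < 2 ∨ n < 0 then band b i else 0) := by
    rw [← Fin.sum_univ_eq_sum_range (fun i => band a i *
      (edge b .left i + if i < 2 ∨ n < 0 then band b i else 0))]
    refine congrArg Neg.neg (Finset.sum_congr rfl fun v _ => ?_)
    obtain ⟨v, hv⟩ : Fin (2 * n.natAbs + 2) := v
    rw [band, edge, band, dif_pos hv, dif_pos hv, dif_pos hv]
    simp only [twistKnot, decide_eq_true_eq]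
  have hrow : ∑ i ∈ Finset.range (2 * n.natAbs), band a (i + 2) *
      (edge b .left (i + 2) + if i + 2 < 2 ∨ n < 0 then band b (i + 2) else 0) =
      band a 2 * (∑ i ∈ Finset.range (2 * n.natAbs), (-1) ^ i * edge b .left (i + 2) +
        2 * n.natAbs * (if n < 0 then band b 2 else 0)) := by
    have hc : (2 * n.natAbs * (if n < 0 then band b 2 else 0) : ℚ) =
        ∑ i ∈ Finset.range (2 * n.natAbs), (if n < 0 then band b 2 else 0) := by
      rw [Finset.sum_const, Finset.card_range, nsmul_eq_mul]
      push_cast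
      ring
    rw [hc, ← Finset.sum_add_distrib, Finset.mul_sum]
    refine Finset.sum_congr rfl fun i hi => ?_
    have hi := Finset.mem_range.1 hi
    rw [band_row ha (by omega), band_row hb (by omega)]
    rcases neg_one_pow_eq_or ℚ i with h | h <;> rw [h] <;> split_ifs <;>
      first | omega | ring
  have hlast := edge_row_last hb hn
  have hsum := sum_edge_row hb (k := n.natAbs - 1) (by omega)
  have hsum' : ∑ i ∈ Finset.range (2 * n.natAbs), (-1) ^ i * edge b .left (i + 2) =
      band b 0 - n.natAbs * band b 2 := by
    rw [show 2 * n.natAbs = 2 * (n.natAbs - 1) + 1 + 1 by omega, Finset.sum_range_succ, hsum,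
      show 2 * (n.natAbs - 1) + 1 + 2 = 2 * n.natAbs + 1 by omega, hlast,
      Odd.neg_one_pow (by rw [Nat.odd_iff]; omega), Nat.cast_sub hN]
    push_cast
    ring
  rw [h0, Finset.sum_range_succ', Finset.sum_range_succ', hrow, hsum', band_clasp ha, zero_add,
    edge_clasp hb, band_clasp hb, twistBilin_apply]
  simp only [Nat.zero_lt_two, Nat.one_lt_two, true_or, if_true]
  -- With `N = |n|`, the edges of the row give `-N`; for `n < 0` the `2N` positive crossings add
  -- `2N`. Either way the result is `-n`.
  rcases lt_or_gt_of_ne hn with h | h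
  · have : (n.natAbs : ℚ) = -n := by
      rw [← Int.cast_natCast, Int.ofNat_natAbs_of_nonpos h.le, Int.cast_neg]
    rw [if_pos h, this]
    ring
  · have : (n.natAbs : ℚ) = n := by
      rw [← Int.cast_natCast, Int.natAbs_of_nonneg h.le]
    rw [if_neg (by omega), this]
    ring

/-- The band coefficients of a cycle with prescribed coefficients `x` on the clasp and `y` on the
row. -/
def cycleBand (x y : ℚ) (i : ℕ) : ℚ :=
  if i = 0 then x else if i = 1 then -x else if i % 2 = 0 then y else -y

/-- The edge coefficients of a cycle with prescribed coefficients `x` on the clasp and `y` on the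
row. -/
def cycleEdge (N : ℕ) (x y : ℚ) : ℕ × Side → ℚ
  | (i, .left) => if i = 0 then 0 else if i = 1 then x else if i % 2 = 0 then -y
      else if i = 2 * N + 1 then -x else 0
  | (i, .right) => if i = 0 then 0 else if i = 1 then -x - y else if i % 2 = 0 then y else 0

theorem cycleEdge_nextNat {N : ℕ} (hN : 0 < N) (x y : ℚ) {i : ℕ} (hi : i < 2 * N + 2) (s : Side) :
    cycleEdge N x y (nextNat N (i, s)) = match nextNat N (i, s) with
      | (j, .left) => cycleEdge N x y (i, s) - cycleBand x y j
      | (j, .right) => cycleEdge N x y (i, s) + cycleBand x y j := by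
  rcases s with _ | _ <;> simp only [nextNat] <;> split_ifs <;>
    simp only [cycleEdge, cycleBand] <;> split_ifs <;> first | contradiction | omega | ring

theorem exists_cycle (hn : n ≠ 0) (x y : ℚ) :
    ∃ a ∈ (twistKnot n).cycles, band a 0 = x ∧ band a 2 = y := by
  have hN : 0 < n.natAbs := Int.natAbs_pos.2 hn
  refine ⟨(fun v : Fin (2 * n.natAbs + 2) => cycleBand x y v,
    fun e : Fin (2 * n.natAbs + 2) × Side => cycleEdge n.natAbs x y (e.1, e.2)), ?_, ?_, ?_⟩
  · rintro ⟨⟨i, hi⟩, s⟩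
    have h := cycleEdge_nextNat hN x y hi s
    have hlt := nextNat_lt n.natAbs i hi s
    obtain ⟨⟨j, t⟩, hj⟩ : ∃ p, nextNat n.natAbs (i, s) = p := ⟨_, rfl⟩
    rw [hj] at h hlt
    rw [show (twistKnot n).next ((⟨i, hi⟩ : Fin _), s) = ((⟨j, hlt⟩ : Fin _), t) from
      next_eq _ i hi s j hlt t hj]
    rcases t with _ | _ <;> exact h
  · rw [band, dif_pos (by omega)]
    rfl
  · rw [band, dif_pos (by omega)]
    simp [cycleBand]

theorem isSeifertForm_twistForm (hn : n ≠ 0) : (twistKnot n).IsSeifertForm (twistForm n) := by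
  have hN : 0 < n.natAbs := Int.natAbs_pos.2 hn
  let v0 : (twistKnot n).X := (⟨0, by omega⟩ : Fin (2 * n.natAbs + 2))
  let v2 : (twistKnot n).X := (⟨2, by omega⟩ : Fin (2 * n.natAbs + 2))
  let π : (twistKnot n).cycles →ₗ[ℚ] ℚ × ℚ :=
    { toFun := fun a => (a.1.1 v0, a.1.1 v2)
      map_add' := fun _ _ => rfl
      map_smul' := fun _ _ => rfl }
  have hπ : ∀ a, π a = (band a.1 0, band a.1 2) := by
    intro a
    rw [band, band, dif_pos (by omega), dif_pos (by omega)]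
    rfl
  refine ⟨π, ?_, ?_, ?_⟩
  · rintro ⟨x, y⟩
    obtain ⟨a, ha, rfl, rfl⟩ := exists_cycle hn x y
    exact ⟨⟨a, ha⟩, hπ _⟩
  · intro a
    constructor
    · intro h
      have h := (hπ a).symm.trans h
      have h0 : band a.1 0 = 0 := congrArg Prod.fst h
      have h2 : band a.1 2 = 0 := congrArg Prod.snd h
      funext ⟨i, hi⟩
      have hb : a.1.1 (⟨i, hi⟩ : Fin _) = band a.1 i := by rw [band, dif_pos hi]
      refine hb.trans ?_
      rcases Nat.lt_or_ge i 2 with hi2 | hi2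
      · interval_cases i
        · exact h0
        · rw [band_clasp a.2, h0, neg_zero]; rfl
      · obtain ⟨j, rfl⟩ := Nat.exists_eq_add_of_le' hi2
        rw [band_row a.2 hi, h2, mul_zero]; rfl
    · intro h
      exact Prod.ext (congrFun h v0) (congrFun h v2)
  · intro a b
    rw [linking_eq hn a.2 b.2, ← hπ, ← hπ]
    rfl

/-- Without a row, the right side of a clasp crossing is a Seifert circle with a single band, so no
cycle passes through a band. -/
theorem isSeifertForm_zero : (twistKnot 0).IsSeifertForm SeifertForm.zero := by
  have key : ∀ a ∈ (twistKnot 0).cycles, a.1 = 0 := by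
    intro a ha
    have h0 : edge a .right 0 = edge a .right 0 + band a 0 :=
      edge_right ha (by simp) (by simp) (by simp [nextNat])
    have h0 : band a 0 = 0 := by linarith
    have h1 := band_clasp ha
    funext ⟨i, hi⟩
    have hb : a.1 (⟨i, hi⟩ : Fin _) = band a i := by rw [band, dif_pos hi]
    refine hb.trans ?_
    simp at hi
    interval_cases i
    · exact h0
    · rw [h1, h0, neg_zero]; rfl
  refine ⟨0, fun x => ⟨0, rfl⟩, fun a => ⟨fun _ => key _ a.2, fun _ => rfl⟩, fun a b => ?_⟩
  rw [KnotDiagram.linking, key _ a.2]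
  simp

end TwistKnot

/-! ## Forms with a cyclic monodromy -/

namespace RatForm

open Polynomial

section Monodromy

variable {V : Type} [AddCommGroup V] [Module ℚ V] {B : V →ₗ[ℚ] V →ₗ[ℚ] ℚ} {T : V →ₗ[ℚ] V}

/-- Using the relation twice, `B x y = B y (T x) = B (T x) (T y)`. -/
theorem monodromy_pow_isometry (hT : ∀ x y, B x y = B y (T x)) (k : ℕ) (x y : V) :
    B ((T ^ k) x) ((T ^ k) y) = B x y := by
  induction k with
  | zero => rfl
  | succ k ih => rw [pow_succ', Module.End.mul_apply, Module.End.mul_apply, ← hT, ← hT, ih]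

/-- The adjoint of `p(T)` is, up to a power of the isometry `T`, the reverse polynomial of `T`. -/
theorem aeval_monodromy_adjoint (hT : ∀ x y, B x y = B y (T x)) (p : ℚ[X]) (x y : V) :
    B (aeval T p x) ((T ^ p.natDegree) y) = B x (aeval T p.reverse y) := by
  rw [aeval_eq_sum_range, aeval_eq_sum_range' (Nat.lt_succ_of_le p.reverse_natDegree_le),
    ← Finset.sum_range_reflect]
  simp only [LinearMap.sum_apply, map_sum, LinearMap.smul_apply, map_smul]
  refine Finset.sum_congr rfl fun i hi => ?_
  have hi : i ≤ p.natDegree := Nat.lt_succ_iff.1 (Finset.mem_range.1 hi)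
  rw [coeff_reverse, show p.natDegree + 1 - 1 - i = p.natDegree - i by omega, revAt_le hi]
  -- The isometry `T ^ i` cancels on both sides and leaves `T ^ (deg p - i)`, the power at which the
  -- reverse has coefficient `p.coeff i`.
  have h : T ^ p.natDegree = T ^ (p.natDegree - i) * T ^ i := by
    rw [← pow_add, Nat.sub_add_cancel hi]
  rw [h, Module.End.mul_apply, monodromy_pow_isometry hT]

/-- The map `g` identifies `W` with `ℚ[X] / (f)`. -/
theorem finrank_eq_natDegree {W : Type} [AddCommGroup W] [Module ℚ W] {g : ℚ[X] →ₗ[ℚ] W}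
    (hg : Function.Surjective g) {f : ℚ[X]} (hf : ∀ p, g p = 0 ↔ f ∣ p) :
    Module.finrank ℚ W = f.natDegree := by
  have hk : LinearMap.ker g = (Ideal.span {f}).restrictScalars ℚ := by
    ext p
    rw [LinearMap.mem_ker, hf, Submodule.restrictScalars_mem, Ideal.mem_span_singleton]
  rw [← finrank_quotient_span_eq_natDegree, ← (g.quotKerEquivOfSurjective hg).finrank_eq, hk]
  exact (Submodule.Quotient.restrictScalarsEquiv ℚ (Ideal.span {f})).finrank_eq

theorem nondegenerate_right [FiniteDimensional ℚ V] (hB : ∀ x, (∀ y, B x y = 0) → x = 0)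
    (hT : ∀ x y, B x y = B y (T x)) (x : V) (hx : ∀ y, B y x = 0) : x = 0 := by
  have hinj : Function.Injective T := by
    rw [← LinearMap.ker_eq_bot, LinearMap.ker_eq_bot']
    intro z hz
    exact hB z fun y => by rw [hT, hz, map_zero]
  obtain ⟨z, rfl⟩ := LinearMap.injective_iff_surjective.1 hinj x
  rw [hB z fun y => by rw [hT, hx], map_zero]

/-- By dimension, `L` is its own orthogonal complement for `B` itself, not only for the
skew-symmetrization. -/
theorem mem_metabolizer [FiniteDimensional ℚ V] (hB : ∀ x, (∀ y, B x y = 0) → x = 0)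
    {L : Submodule ℚ V} (hL : 2 * Module.finrank ℚ L = Module.finrank ℚ V)
    (hz : ∀ x ∈ L, ∀ y ∈ L, B x y = 0) {x : V} (hx : ∀ y ∈ L, B y x = 0) : x ∈ L := by
  have hker : LinearMap.ker B = ⊥ := by
    rw [LinearMap.ker_eq_bot']
    exact fun a ha => hB a fun b => by rw [ha, LinearMap.zero_apply]
  have hfin := LinearMap.BilinForm.finrank_add_finrank_orthogonal' (B := B) L
  rw [hker, inf_bot_eq, finrank_bot, add_zero] at hfin
  have hle : L ≤ LinearMap.BilinForm.orthogonal B L := fun a ha b hb => hz b hb a ha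
  rw [Submodule.eq_of_le_of_finrank_eq hle (by omega)]
  exact hx

/-- If a metabolic form has a monodromy with a cyclic vector, then the characteristic polynomial of
the monodromy is a norm. -/
theorem exists_norm [FiniteDimensional ℚ V] (hB : ∀ x, (∀ y, B x y = 0) → x = 0)
    (hT : ∀ x y, B x y = B y (T x)) {v : V} (hv : ∀ x, ∃ p : ℚ[X], aeval T p v = x) {D : ℚ[X]}
    (hD : aeval T D v = 0) (hD0 : D ≠ 0) (hdeg : D.natDegree = Module.finrank ℚ V)
    (hmet : Metabolic B) : ∃ f : ℚ[X], ∃ c : ℚ, c ≠ 0 ∧ C c * D = f.reverse * f := by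
  obtain ⟨L, hL, hz⟩ := hmet
  -- The metabolizer is invariant: `B y (T x) = B x y = 0` for `x`, `y` in `L`.
  have hTL : ∀ x ∈ L, T x ∈ L := fun x hx =>
    mem_metabolizer hB hL hz fun y hy => by rw [← hT, hz x hx y hy]
  have hpL : ∀ (p : ℚ[X]), ∀ x ∈ L, aeval T p x ∈ L := by
    intro p x hx
    induction p using Polynomial.induction_on' with
    | add p q hp hq => rw [map_add]; exact L.add_mem hp hq
    | monomial k a =>
      rw [aeval_monomial, Module.End.mul_apply, Module.algebraMap_end_apply]
      refine L.smul_mem _ ?_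
      induction k with
      | zero => exact hx
      | succ k ih => rw [pow_succ', Module.End.mul_apply]; exact hTL _ ih
  let g : ℚ[X] →ₗ[ℚ] V := (LinearMap.applyₗ v).comp (aeval T).toLinearMap
  have hg : ∀ p, g p = aeval T p v := fun p => rfl
  have hsurj : Function.Surjective g := hv
  have hgmul : ∀ p q, g (p * q) = aeval T p (g q) := by
    intro p q
    rw [hg, hg, map_mul, Module.End.mul_apply]
  -- Through the cyclic vector, invariant subspaces correspond to ideals of `ℚ[X]`: `f` will
  -- generate the ideal of `L`, and `d` the ideal of the zero subspace.
  have hideal : ∀ M : Submodule ℚ V, (∀ (p : ℚ[X]), ∀ x ∈ M, aeval T p x ∈ M) →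
      ∃ f : ℚ[X], ∀ p, g p ∈ M ↔ f ∣ p := by
    intro M hM
    let I : Ideal ℚ[X] :=
      { carrier := {p | g p ∈ M}
        zero_mem' := by simp
        add_mem' := fun {p q} hp hq => by
          change g (p + q) ∈ M
          rw [map_add]
          exact M.add_mem hp hq
        smul_mem' := fun p q hq => by
          change g (p * q) ∈ M
          rw [hgmul]
          exact hM p _ hq }
    exact ⟨Submodule.IsPrincipal.generator I, fun p =>
      Submodule.IsPrincipal.mem_iff_generator_dvd I (x := p)⟩
  obtain ⟨f, hf⟩ := hideal L hpL
  obtain ⟨d, hd⟩ := hideal ⊥ (by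
    intro p x hx
    rw [Submodule.mem_bot] at hx ⊢
    rw [hx, map_zero])
  simp only [Submodule.mem_bot] at hd
  have hdd : d.natDegree = D.natDegree := by rw [hdeg, finrank_eq_natDegree hsurj hd]
  have hdD : d ∣ D := (hd D).1 hD
  have hfdeg : 2 * f.natDegree = D.natDegree := by
    have h := finrank_eq_natDegree (g := L.mkQ ∘ₗ g) (f := f)
      (L.mkQ_surjective.comp hsurj) (fun p => by
        rw [LinearMap.comp_apply, Submodule.mkQ_apply, Submodule.Quotient.mk_eq_zero, hf])
    have h' := L.finrank_quotient_add_finrank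
    omega
  have hf0 : f ≠ 0 := by
    rintro rfl
    exact hD0 (zero_dvd_iff.1 ((hf D).1 (by rw [hg, hD]; exact L.zero_mem)))
  -- Pairing an arbitrary `q(T) v` with this vector gives, by the adjoint formula, a value of `B` on
  -- two elements of `L`.
  have hnorm : g (f.reverse * f) = 0 := by
    rw [hgmul]
    refine nondegenerate_right hB hT _ fun x => ?_
    obtain ⟨q, rfl⟩ := hv x
    rw [← aeval_monodromy_adjoint hT]
    have hfL : g f ∈ L := (hf f).2 dvd_rfl
    refine hz _ ?_ _ ?_
    · have : aeval T f (aeval T q v) = aeval T q (g f) := by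
        rw [← hg, ← hgmul, mul_comm, hgmul]
      rw [this]
      exact hpL q _ hfL
    · have := hpL (X ^ f.natDegree) _ hfL
      rwa [map_pow, aeval_X] at this
  -- As `d` divides `D` and has the same degree, the two are associated.
  have hDd : D ∣ d := by
    obtain ⟨q, hq⟩ := hdD
    have hd0 : d ≠ 0 := by rintro rfl; exact hD0 (by rw [hq, zero_mul])
    have hq0 : q ≠ 0 := by rintro rfl; exact hD0 (by rw [hq, mul_zero])
    have := natDegree_mul hd0 hq0
    rw [← hq] at this
    have hu : IsUnit q := isUnit_iff_degree_eq_zero.2 (by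
      rw [degree_eq_natDegree hq0, show q.natDegree = 0 by omega]; rfl)
    rw [hq]
    exact hu.mul_right_dvd.2 dvd_rfl
  -- The cofactor is constant, since `f.reverse * f` has degree at most `2 * deg f = deg D`.
  obtain ⟨c, hc⟩ := hDd.trans ((hd _).1 hnorm)
  have hr0 : f.reverse ≠ 0 := by rwa [Ne, reverse_eq_zero]
  have hc0 : c ≠ 0 := by
    rintro rfl
    exact mul_ne_zero hr0 hf0 (by rw [hc, mul_zero])
  have h1 := natDegree_mul hD0 hc0
  have h2 := natDegree_mul hr0 hf0
  have h3 := f.reverse_natDegree_le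
  rw [← hc] at h1
  have hcc := eq_C_of_natDegree_eq_zero (p := c) (by omega)
  refine ⟨f, c.coeff 0, ?_, ?_⟩
  · intro h
    rw [h, C_0] at hcc
    exact hc0 hcc
  · rw [← hcc, hc, mul_comm]

end Monodromy

/-- A norm has no simple root that is conjugate to its inverse. -/
theorem derivative_eq_zero_of_norm {K : Type*} [Field K] [Algebra ℚ K] {D f : ℚ[X]} {c : ℚ}
    (hc : c ≠ 0) (h : C c * D = f.reverse * f) {β : K} (hβ0 : β ≠ 0) (hβ : aeval β D = 0)
    (hconj : ∀ q : ℚ[X], aeval β q = 0 ↔ aeval β⁻¹ q = 0) : aeval β (derivative D) = 0 := by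
  have hrev : aeval β f.reverse = 0 ↔ aeval β f = 0 := by
    let := invertibleOfNonzero (inv_ne_zero hβ0)
    have := eval₂_reverse_eq_zero_iff (algebraMap ℚ K) β⁻¹ f
    rw [invOf_eq_inv, inv_inv] at this
    exact this.trans (hconj f).symm
  have h1 : aeval β f.reverse * aeval β f = 0 := by
    rw [← map_mul, ← h, map_mul, hβ, mul_zero]
  have hf : aeval β f = 0 := by
    rcases mul_eq_zero.1 h1 with h1 | h1
    · exact hrev.1 h1
    · exact h1
  -- Both factors vanish at `β`, so both terms of the product rule vanish.
  have h2 := congrArg (fun p => aeval β (derivative p)) h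
  simp only [derivative_mul, derivative_C, zero_mul, zero_add, map_add, map_mul, hf, hrev.2 hf,
    mul_zero, add_zero, aeval_C] at h2
  exact (mul_eq_zero.1 h2).resolve_left (by
    exact fun h => hc ((map_eq_zero_iff _ (algebraMap ℚ K).injective).1 h))

/-! ## The monodromy of parallel copies -/

section Shift

variable {V : Type} [AddCommGroup V] [Module ℚ V]

/-- The monodromy of `s + 1` parallel copies of a form with monodromy `t`. -/
def shift (s : ℕ) (t : V →ₗ[ℚ] V) : (Fin (s + 1) → V) →ₗ[ℚ] (Fin (s + 1) → V) where
  toFun x j := if h : (j : ℕ) + 1 < s + 1 then x ⟨j + 1, h⟩ else t (x 0)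
  map_add' x y := by
    funext j
    simp only [Pi.add_apply]
    split_ifs <;> simp
  map_smul' c x := by
    funext j
    simp only [Pi.smul_apply, RingHom.id_apply]
    split_ifs <;> simp

theorem shift_apply (s : ℕ) (t : V →ₗ[ℚ] V) (x : Fin (s + 1) → V) (j : Fin (s + 1)) :
    shift s t x j = if h : (j : ℕ) + 1 < s + 1 then x ⟨j + 1, h⟩ else t (x 0) := rfl

/-- Exchanging `x` and `y` reverses the comparison of indices from `≤` to `<`, and moving `x` down
by one copy restores it. The copy `x 0` precedes every copy of `y`; it moves to the last place at
the cost of one application of `t`. -/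
theorem parallel_eq_shift {B : V →ₗ[ℚ] V →ₗ[ℚ] ℚ} {t : V →ₗ[ℚ] V}
    (ht : ∀ x y, B x y = B y (t x)) (s : ℕ) (x y : Fin (s + 1) → V) :
    parallel (s + 1) B x y = parallel (s + 1) B y (shift s t x) := by
  have h1 : ∀ j : Fin s, shift s t x j.castSucc = x j.succ := by
    intro j
    rw [shift_apply, dif_pos (by simp)]
    rfl
  have h2 : shift s t x (Fin.last s) = t (x 0) := by
    rw [shift_apply, dif_neg (by simp)]
  rw [parallel_apply, parallel_apply, Finset.sum_comm (f := fun i j => ite (i ≤ j) (B (y i) _) _),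
    Fin.sum_univ_succ, Fin.sum_univ_castSucc (fun j => ∑ i, ite (i ≤ j) (B (y i) _) _), add_comm]
  congr 1
  · refine Finset.sum_congr rfl fun i _ => Finset.sum_congr rfl fun j _ => ?_
    rw [h1]
    by_cases h : i.succ ≤ j
    · rw [if_pos h, if_neg (by rw [not_le]; exact Fin.castSucc_lt_iff_succ_le.2 h)]
    · rw [if_neg h, if_pos (by rw [← not_lt, Fin.castSucc_lt_iff_succ_le]; exact h)]
  · refine Finset.sum_congr rfl fun j _ => ?_
    rw [h2, if_pos (Fin.zero_le j), if_pos (Fin.le_last j), ht]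

theorem parallel_nondegenerate {B : V →ₗ[ℚ] V →ₗ[ℚ] ℚ} (hω : Nonsing B)
    (hB : ∀ x, (∀ y, B x y = 0) → x = 0) (s : ℕ) (x : Fin (s + 1) → V)
    (hx : ∀ y, parallel (s + 1) B x y = 0) : x = 0 := by
  have h : ∀ (w : V) (j : Fin (s + 1)), ∑ i, (if i ≤ j then B (x i) w else B w (x i)) = 0 := by
    intro w j
    have := hx (Pi.single j w)
    rw [parallel_apply] at this
    rw [← this]
    refine Finset.sum_congr rfl fun i _ => ?_
    rw [Finset.sum_eq_single j]
    · simp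
    · intro k _ hk
      simp [Pi.single_eq_of_ne hk]
    · simp
  -- The equations `h w k.succ` and `h w k.castSucc` differ only in the order of the arguments in
  -- the term `i = k.succ`; their difference is the skew-symmetrization at `x k.succ`.
  have hsucc : ∀ k : Fin s, x k.succ = 0 := by
    intro k
    refine hω _ fun w => ?_
    have h1 := h w k.succ
    rw [← h w k.castSucc, ← sub_eq_zero, ← Finset.sum_sub_distrib,
      Finset.sum_eq_single k.succ] at h1
    · rw [if_pos le_rfl, if_neg (by simp), sub_eq_zero] at h1
      exact h1
    · intro i _ hi
      have : i ≤ k.succ ↔ i ≤ k.castSucc := by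
        rw [Fin.le_def, Fin.le_def]
        have : (i : ℕ) ≠ k.succ := fun h => hi (Fin.ext h)
        simp at this ⊢
        omega
      simp [this]
    · simp
  have hzero : x 0 = 0 := by
    refine hB _ fun w => ?_
    have h0 := h w 0
    rw [Fin.sum_univ_succ] at h0
    simpa [hsucc] using h0
  funext i
  refine Fin.cases hzero hsucc i

theorem shift_pow_apply (s : ℕ) (t : V →ₗ[ℚ] V) (x : Fin (s + 1) → V) {k : ℕ} (hk : k ≤ s + 1)
    (j : Fin (s + 1)) :
    (shift s t ^ k) x j = if h : (j : ℕ) + k < s + 1 then x ⟨j + k, h⟩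
      else t (x ⟨j + k - (s + 1), by omega⟩) := by
  induction k generalizing j with
  | zero => rw [dif_pos (by omega)]; rfl
  | succ k ih =>
    rw [pow_succ', Module.End.mul_apply, shift_apply]
    by_cases h : (j : ℕ) + 1 < s + 1
    · rw [dif_pos h, ih (by omega)]
      simp only [show (j : ℕ) + 1 + k = j + (k + 1) by ring]
    · rw [dif_neg h, ih (by omega), dif_pos (by simp; omega), dif_neg (by omega)]
      congr 2
      apply Fin.ext
      simp
      omega

theorem shift_pow_self (s : ℕ) (t : V →ₗ[ℚ] V) (x : Fin (s + 1) → V) (j : Fin (s + 1)) :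
    (shift s t ^ (s + 1)) x j = t (x j) := by
  rw [shift_pow_apply s t x le_rfl, dif_neg (by omega)]
  congr 2
  apply Fin.ext
  simp

/-- Powers of the shift up to `s` carry `w` from the last copy to every other one, and `s + 1`
further steps apply `t` in place. -/
theorem shift_cyclic (s : ℕ) {t : V →ₗ[ℚ] V} {w : V} (hw : ∀ u, ∃ a b : ℚ, u = a • w + b • t w)
    (x : Fin (s + 1) → V) :
    ∃ p : ℚ[X], aeval (shift s t) p (Pi.single (Fin.last s) w) = x := by
  let g : ℚ[X] →ₗ[ℚ] (Fin (s + 1) → V) :=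
    (LinearMap.applyₗ (Pi.single (Fin.last s) w)).comp (aeval (shift s t)).toLinearMap
  change x ∈ LinearMap.range g
  have h1 : ∀ j : Fin (s + 1),
      (shift s t ^ (s - j)) (Pi.single (Fin.last s) w) = Pi.single j w := by
    intro j
    funext i
    rw [shift_pow_apply _ _ _ (by omega)]
    by_cases hij : i = j
    · subst hij
      rw [dif_pos (by omega), Pi.single_eq_same,
        show (⟨(i : ℕ) + (s - i), by omega⟩ : Fin (s + 1)) = Fin.last s from
          Fin.ext (by simp; omega), Pi.single_eq_same]
    · have hij' : (i : ℕ) ≠ j := fun h => hij (Fin.ext h)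
      rw [Pi.single_eq_of_ne hij]
      split_ifs with h
      · exact Pi.single_eq_of_ne (fun h => by
          have := congrArg Fin.val h
          simp at this
          omega) _
      · rw [Pi.single_eq_of_ne (fun h => by
          have := congrArg Fin.val h
          simp at this
          omega), map_zero]
  have h2 : ∀ j : Fin (s + 1), Pi.single j w ∈ LinearMap.range g := fun j =>
    ⟨X ^ (s - j : ℕ), by rw [← h1]; simp [g]⟩
  have h3 : ∀ j : Fin (s + 1), Pi.single j (t w) ∈ LinearMap.range g := by
    intro j
    have : Pi.single j (t w) = (shift s t ^ (s + 1)) (Pi.single j w) := by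
      funext i
      rw [shift_pow_self]
      by_cases hij : i = j
      · subst hij; simp
      · simp [Pi.single_eq_of_ne hij]
    refine ⟨X ^ (s + 1) * X ^ (s - j : ℕ), ?_⟩
    rw [this, ← h1]
    simp [g]
  have h4 : ∀ (j : Fin (s + 1)) (u : V), Pi.single j u ∈ LinearMap.range g := by
    intro j u
    obtain ⟨a, b, rfl⟩ := hw u
    rw [Pi.single_add, Pi.single_smul, Pi.single_smul]
    exact add_mem (Submodule.smul_mem _ _ (h2 j)) (Submodule.smul_mem _ _ (h3 j))
  rw [← Finset.univ_sum_single x]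
  exact Submodule.sum_mem _ fun j _ => h4 j _

end Shift

end RatForm

/-! ## Parallel copies of twist forms -/

namespace TwistKnot

open Polynomial

/-- The Alexander polynomial of a twist knot in the variable `X ^ r`. -/
noncomputable def alexander (n : ℤ) (r : ℕ) : ℚ[X] :=
  C (n : ℚ) * X ^ (2 * r) - C (2 * n + 1 : ℚ) * X ^ r + C (n : ℚ)

theorem aeval_alexander {A : Type*} [Ring A] [Algebra ℚ A] (n : ℤ) (r : ℕ) (x : A) :
    aeval x (alexander n r) =
      (n : ℚ) • (x ^ r) ^ 2 - (2 * n + 1 : ℚ) • x ^ r + (n : ℚ) • 1 := by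
  simp only [alexander, map_add, map_sub, map_mul, map_pow, aeval_C, aeval_X, Algebra.smul_def,
    mul_one, ← pow_mul, mul_comm r 2]

theorem natDegree_alexander {n : ℤ} (hn : n ≠ 0) {r : ℕ} (hr : 0 < r) :
    (alexander n r).natDegree = 2 * r := by
  have : (n : ℚ) ≠ 0 := by exact_mod_cast hn
  rw [alexander, natDegree_add_C, natDegree_sub_eq_left_of_natDegree_lt,
    natDegree_C_mul_X_pow _ _ this]
  rw [natDegree_C_mul_X_pow _ _ this]
  exact (natDegree_C_mul_X_pow_le _ _).trans_lt (by omega)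

/-- The monodromy of a twist knot. -/
def monodromy (n : ℤ) : ℚ × ℚ →ₗ[ℚ] ℚ × ℚ where
  toFun u := (u.1 + u.2, (n : ℚ)⁻¹ * u.1 + ((n : ℚ)⁻¹ + 1) * u.2)
  map_add' u w := by ext <;> simp <;> ring
  map_smul' c u := by ext <;> simp <;> ring

theorem monodromy_apply (n : ℤ) (u : ℚ × ℚ) :
    monodromy n u = (u.1 + u.2, (n : ℚ)⁻¹ * u.1 + ((n : ℚ)⁻¹ + 1) * u.2) := rfl

theorem twistBilin_monodromy {n : ℤ} (hn : n ≠ 0) (u w : ℚ × ℚ) :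
    twistBilin n u w = twistBilin n w (monodromy n u) := by
  have : (n : ℚ) ≠ 0 := by exact_mod_cast hn
  simp only [twistBilin_apply, monodromy_apply]
  field_simp
  ring

theorem exists_alexander_norm {n : ℤ} (hn : n ≠ 0) {r : ℕ} (hr : 0 < r)
    (h : RatForm.Metabolic (RatForm.parallel r (twistBilin n))) :
    ∃ f : ℚ[X], ∃ c : ℚ, c ≠ 0 ∧ C c * alexander n r = f.reverse * f := by
  have hn' : (n : ℚ) ≠ 0 := by exact_mod_cast hn
  obtain ⟨s, rfl⟩ := Nat.exists_eq_add_of_le' hr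
  have hdeg := natDegree_alexander hn hr
  -- The monodromy sends `(1, 0)` to `(1, 1/n)`.
  have hw : ∀ u : ℚ × ℚ, ∃ a b : ℚ, u = a • ((1 : ℚ), (0 : ℚ)) + b • monodromy n (1, 0) := by
    rintro ⟨x, y⟩
    refine ⟨x - n * y, n * y, ?_⟩
    rw [monodromy_apply]
    ext <;> simp
    field_simp
  refine RatForm.exists_norm (V := Fin (s + 1) → ℚ × ℚ)
    (RatForm.parallel_nondegenerate (twistBilin_nonsing n) ?_ s)
    (RatForm.parallel_eq_shift (twistBilin_monodromy hn) s) (RatForm.shift_cyclic s hw) ?_ ?_ ?_ h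
  · intro u hu
    have h1 := hu (1, 0)
    have h2 := hu (0, 1)
    change twistBilin n u _ = 0 at h1 h2
    simp only [twistBilin_apply] at h1 h2
    have h3 : u.2 = 0 := by simpa [hn'] using h2
    rw [h3] at h1
    exact Prod.ext (by simpa using h1) h3
  · rw [aeval_alexander, pow_two]
    funext j
    simp only [LinearMap.add_apply, LinearMap.sub_apply, LinearMap.smul_apply, Pi.add_apply,
      Pi.sub_apply, Pi.smul_apply, Module.End.mul_apply, RatForm.shift_pow_self, monodromy_apply,
      Module.End.one_apply]
    ext
    · simp
      field_simp
      ring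
    · simp
      field_simp
      ring
  · intro h0
    rw [h0, natDegree_zero] at hdeg
    omega
  · rw [hdeg, Module.finrank_pi_fintype]
    simp
    ring

/-- If `β` is a root of the Alexander polynomial in `X ^ r` and conjugate to its inverse, then `r`
parallel copies of the twist form are not metabolic. -/
theorem not_metabolic_of_conjugate {K : Type*} [Field K] [Algebra ℚ K] {n : ℤ} (hn : n ≠ 0) {r : ℕ}
    (hr : 0 < r) {β : K} (hβ : (n : K) * (β ^ r) ^ 2 - (2 * n + 1) * β ^ r + n = 0)
    (hconj : ∀ q : ℚ[X], aeval β q = 0 ↔ aeval β⁻¹ q = 0) :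
    ¬ RatForm.Metabolic (RatForm.parallel r (twistBilin n)) := by
  intro h
  have : CharZero K := algebraRat.charZero K
  have hn' : (n : K) ≠ 0 := by exact_mod_cast hn
  obtain ⟨f, c, hc, hf⟩ := exists_alexander_norm hn hr h
  have hβ0 : β ≠ 0 := by
    rintro rfl
    rw [zero_pow hr.ne'] at hβ
    simp [hn] at hβ
  have key := RatForm.derivative_eq_zero_of_norm hc hf hβ0
    (by rw [aeval_alexander, ← hβ]; simp [Algebra.smul_def]) hconj
  have h1 : (r : K) * β ^ (r - 1) * (2 * n * β ^ r - (2 * n + 1)) = 0 := by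
    rw [← key]
    have : β ^ (2 * r - 1) = β ^ (r - 1) * β ^ r := by
      rw [← pow_add]
      congr 1
      omega
    simp [alexander, derivative_mul, derivative_X_pow, this]
    ring
  have h2 : 2 * n * β ^ r - (2 * n + 1) = 0 := by
    refine (mul_eq_zero.1 h1).resolve_left (mul_ne_zero ?_ (pow_ne_zero _ hβ0))
    exact_mod_cast hr.ne'
  -- A double root forces the discriminant `(2n+1)² - 4n² = 4n+1` to vanish.
  have h3 : ((4 * n + 1 : ℤ) : K) = 0 := by
    push_cast
    linear_combination (2 * n * β ^ r - (2 * n + 1)) * h2 - 4 * n * hβ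
  have : 4 * n + 1 = 0 := by exact_mod_cast h3
  omega

end TwistKnot

/-! ## Roots of the Alexander polynomial that are conjugate to their inverses -/

namespace TwistKnot

open Polynomial IntermediateField

theorem natDegree_minpoly_dvd_of_mem {K : Type*} [Field K] [Algebra ℚ K] {x y : K}
    (hx : IsIntegral ℚ x) (hy : IsIntegral ℚ y) (h : x ∈ ℚ⟮y⟯) :
    (minpoly ℚ x).natDegree ∣ (minpoly ℚ y).natDegree := by
  rw [← adjoin.finrank hx, ← adjoin.finrank hy]
  exact finrank_dvd_of_le_right (by simpa using h)

theorem aeval_alexander_field {K : Type*} [Field K] [Algebra ℚ K] (n : ℤ) (r : ℕ) (x : K) :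
    aeval x (alexander n r) = (n : K) * (x ^ r) ^ 2 - (2 * n + 1) * x ^ r + n := by
  have : CharZero K := algebraRat.charZero K
  rw [aeval_alexander]
  simp [Algebra.smul_def]

theorem minpoly_dvd_alexander {K : Type*} [Field K] [Algebra ℚ K] {n : ℤ} {r : ℕ} {x : K}
    (h : (n : K) * (x ^ r) ^ 2 - (2 * n + 1) * x ^ r + n = 0) :
    minpoly ℚ x ∣ alexander n r := by
  refine minpoly.dvd ℚ x ?_
  rw [aeval_alexander_field, h]

theorem isIntegral_of_alexander {K : Type*} [Field K] [Algebra ℚ K] {n : ℤ} (hn : n ≠ 0) {r : ℕ}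
    (hr : 0 < r) {x : K} (h : (n : K) * (x ^ r) ^ 2 - (2 * n + 1) * x ^ r + n = 0) :
    IsIntegral ℚ x := by
  refine IsAlgebraic.isIntegral ⟨alexander n r, ?_, ?_⟩
  · intro h0
    have := natDegree_alexander hn hr
    rw [h0, natDegree_zero] at this
    omega
  · rw [aeval_alexander_field, h]

theorem alexander_root_of_minpoly_root {K L : Type*} [Field K] [Algebra ℚ K] [Field L] [Algebra ℚ L]
    {n : ℤ} {r : ℕ} {x : K} (h : (n : K) * (x ^ r) ^ 2 - (2 * n + 1) * x ^ r + n = 0) {y : L}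
    (hy : aeval y (minpoly ℚ x) = 0) : (n : L) * (y ^ r) ^ 2 - (2 * n + 1) * y ^ r + n = 0 := by
  have := aeval_eq_zero_of_dvd_aeval_eq_zero (minpoly_dvd_alexander h) hy
  rwa [aeval_alexander_field] at this

theorem isSquare_of_mul_four_mul_add_one {n : ℤ} (hn : 0 < n) (h : IsSquare (n * (4 * n + 1))) :
    IsSquare n := by
  obtain ⟨m, hm⟩ := h
  have hc : IsCoprime n (4 * n + 1) := ⟨-4, 1, by ring⟩
  obtain ⟨a, ha | ha⟩ := Int.sq_of_isCoprime hc (hm.trans (sq m).symm)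
  · exact ⟨a, by rw [ha, sq]⟩
  · nlinarith [sq_nonneg a]

/-! ### Real roots of the Alexander polynomial and the degrees of their square roots -/

section Real

variable {n : ℤ} {α : ℝ}

theorem ne_ratCast_of_alexander (h4 : ¬ IsSquare (4 * n + 1))
    (hα : (n : ℝ) * α ^ 2 - (2 * n + 1) * α + n = 0) (q : ℚ) : (q : ℝ) ≠ α := by
  rintro rfl
  apply h4
  rw [← Rat.isSquare_intCast_iff]
  refine ⟨2 * n * q - (2 * n + 1), ?_⟩
  have : (n : ℚ) * q ^ 2 - (2 * n + 1) * q + n = 0 := by exact_mod_cast hα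
  push_cast
  linear_combination -4 * n * this

theorem natDegree_minpoly_root (hn : 0 < n) (h4 : ¬ IsSquare (4 * n + 1))
    (hα : (n : ℝ) * α ^ 2 - (2 * n + 1) * α + n = 0) : (minpoly ℚ α).natDegree = 2 := by
  have hα' : (n : ℝ) * (α ^ 1) ^ 2 - (2 * n + 1) * α ^ 1 + n = 0 := by rwa [pow_one]
  have hint := isIntegral_of_alexander hn.ne' one_pos hα'
  have hdeg := natDegree_alexander hn.ne' one_pos
  have hle := natDegree_le_of_dvd (minpoly_dvd_alexander hα') (by
    intro h0
    rw [h0, natDegree_zero] at hdeg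
    omega)
  have hge := (minpoly.two_le_natDegree_iff hint).2 (by
    rintro ⟨q, hq⟩
    exact ne_ratCast_of_alexander h4 hα q hq)
  omega

theorem sq_sub_inv_eq (hn : 0 < n) {γ : ℝ} (hγ : γ ≠ 0)
    (h : (n : ℝ) * (γ ^ 2) ^ 2 - (2 * n + 1) * γ ^ 2 + n = 0) : n * (γ - γ⁻¹) ^ 2 = 1 := by
  have : (n : ℝ) ≠ 0 := by exact_mod_cast hn.ne'
  field_simp
  linear_combination h

/-- The number `δ = γ - γ⁻¹` is a square root of `1/n`, hence irrational, and `γ² = δγ + 1`.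
Subtracting a rational quadratic equation for `γ` leaves a linear one over `ℚ(δ)`, so `γ = p + qδ`;
the relation `γ² = δγ + 1` then forces `n` or `4n+1` to be a square. -/
theorem sq_root_ne_quadratic (hn : 0 < n) (h1 : ¬ IsSquare n) (h4 : ¬ IsSquare (4 * n + 1)) {γ : ℝ}
    (hγ : γ ≠ 0) (h : (n : ℝ) * (γ ^ 2) ^ 2 - (2 * n + 1) * γ ^ 2 + n = 0) (b c : ℚ) :
    γ ^ 2 + b * γ + c ≠ 0 := by
  intro hq
  have hn' : (n : ℚ) ≠ 0 := by exact_mod_cast hn.ne'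
  have hnR : (n : ℝ) ≠ 0 := by exact_mod_cast hn.ne'
  have hδ := sq_sub_inv_eq hn hγ h
  have hγδ : γ ^ 2 = (γ - γ⁻¹) * γ + 1 := by field_simp; ring
  set δ := γ - γ⁻¹ with hδdef
  have hrat : ∀ q : ℚ, n * q ^ 2 ≠ 1 := by
    intro q hq
    apply h1
    rw [← Rat.isSquare_intCast_iff]
    exact ⟨n * q, by linear_combination -(n : ℚ) * hq⟩
  have hirr : ∀ p q : ℚ, (p : ℝ) + q * δ = 0 → p = 0 ∧ q = 0 := by
    intro p q hpq
    have hq0 : q = 0 := by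
      by_contra hq0
      apply hrat (p / q)
      have hq0' : (q : ℝ) ≠ 0 := by exact_mod_cast hq0
      have : δ = -(p / q) := by field_simp; linear_combination hpq
      rw [this, neg_sq] at hδ
      exact_mod_cast hδ
    subst hq0
    exact ⟨by simpa using hpq, rfl⟩
  -- This is `n` times the norm of `b + δ`, the denominator needed to solve `hlin` for `γ`.
  set e : ℚ := n * b ^ 2 - 1 with he
  have he0 : e ≠ 0 := sub_ne_zero.2 (hrat b)
  have heR : (e : ℝ) ≠ 0 := by exact_mod_cast he0
  have heR' : (e : ℝ) = n * b ^ 2 - 1 := by rw [he]; push_cast; ring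
  have hlin : (δ + b) * γ = -(c + 1) := by linear_combination hq - hγδ
  have hγeq : γ = -(n * (c + 1) * b) / e + n * (c + 1) / e * δ := by
    field_simp
    rw [heR']
    linear_combination (n * b - n * δ) * hlin + γ * hδ
  set p : ℚ := -(n * (c + 1) * b) / e with hp
  set q : ℚ := n * (c + 1) / e with hq'
  have hγpq : γ = p + q * δ := by rw [hγeq, hp, hq']; push_cast; ring
  -- These are the coefficients of `1` and `δ` in `γ² - δγ - 1`.
  obtain ⟨k1, k2⟩ := hirr (p ^ 2 + (q ^ 2 - q) / n - 1) (p * (2 * q - 1)) (by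
    have hδ' : δ ^ 2 = 1 / n := by field_simp; linear_combination hδ
    rw [hγpq] at hγδ
    push_cast
    linear_combination hγδ - (q ^ 2 - q) * hδ')
  -- If `p = 0`, then `4n+1 = (2q-1)²`. If `q = 1/2`, then `n(4n+1) = (2np)²`, and coprimality makes
  -- `n` a square.
  rcases mul_eq_zero.1 k2 with k2 | k2
  · apply h4
    rw [← Rat.isSquare_intCast_iff]
    rw [k2] at k1
    field_simp at k1
    exact ⟨2 * q - 1, by push_cast; linear_combination -4 * k1⟩
  · refine h1 (isSquare_of_mul_four_mul_add_one hn ?_)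
    rw [← Rat.isSquare_intCast_iff]
    have k3 : q = 1 / 2 := by linear_combination k2 / 2
    rw [k3] at k1
    field_simp at k1
    exact ⟨2 * n * p, by push_cast; linear_combination -n * k1⟩

/-- The degree is at most four, even because `ℚ(γ)` contains the quadratic field of `γ²`, and not
two. -/
theorem natDegree_minpoly_sq_root (hn : 0 < n) (h1 : ¬ IsSquare n) (h4 : ¬ IsSquare (4 * n + 1))
    {γ : ℝ} (hγ : γ ≠ 0) (h : (n : ℝ) * (γ ^ 2) ^ 2 - (2 * n + 1) * γ ^ 2 + n = 0) :
    (minpoly ℚ γ).natDegree = 4 := by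
  have hint := isIntegral_of_alexander hn.ne' two_pos h
  have hdeg := natDegree_alexander hn.ne' two_pos
  have hle := natDegree_le_of_dvd (minpoly_dvd_alexander h) (by
    intro h0
    rw [h0, natDegree_zero] at hdeg
    omega)
  have hdvd := natDegree_minpoly_dvd_of_mem (hint.pow 2) hint
    (pow_mem (mem_adjoin_simple_self ℚ γ) 2)
  rw [natDegree_minpoly_root hn h4 h] at hdvd
  have hpos := minpoly.natDegree_pos hint
  have h2 : (minpoly ℚ γ).natDegree ≠ 2 := by
    intro h2
    have hroot := minpoly.aeval ℚ γ
    have hlead : (minpoly ℚ γ).coeff 2 = 1 := by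
      rw [← h2]
      exact minpoly.monic hint
    rw [aeval_eq_sum_range, h2] at hroot
    simp only [Finset.sum_range_succ, Finset.sum_range_zero, hlead, Algebra.smul_def] at hroot
    refine sq_root_ne_quadratic hn h1 h4 hγ h ((minpoly ℚ γ).coeff 1) ((minpoly ℚ γ).coeff 0) ?_
    rw [← hroot]
    simp
    ring
  omega

theorem eq_or_eq_inv_of_alexander (hn : 0 < n) (hα : (n : ℝ) * α ^ 2 - (2 * n + 1) * α + n = 0)
    {y : ℝ} (hy : (n : ℝ) * y ^ 2 - (2 * n + 1) * y + n = 0) : y = α ∨ y = α⁻¹ := by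
  have hnR : (n : ℝ) ≠ 0 := by exact_mod_cast hn.ne'
  have hα0 : α ≠ 0 := by
    rintro rfl
    simp [hn.ne'] at hα
  have : (y - α) * (α * y - 1) = 0 := by
    have : (n : ℝ) * ((y - α) * (α * y - 1)) = 0 := by linear_combination α * hy - y * hα
    exact (mul_eq_zero.1 this).resolve_left hnR
  rcases mul_eq_zero.1 this with h | h
  · exact Or.inl (sub_eq_zero.1 h)
  · exact Or.inr (eq_inv_of_mul_eq_one_right (sub_eq_zero.1 h))

theorem eq_or_eq_inv_of_pow_alexander (hn : 0 < n) {r : ℕ} (hr : 0 < r) {β : ℝ} (hβ0 : 0 < β)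
    (hβ : (n : ℝ) * (β ^ r) ^ 2 - (2 * n + 1) * β ^ r + n = 0) {y : ℝ} (hy0 : 0 < y)
    (hy : (n : ℝ) * (y ^ r) ^ 2 - (2 * n + 1) * y ^ r + n = 0) : y = β ∨ y = β⁻¹ := by
  rcases eq_or_eq_inv_of_alexander hn hβ hy with h | h
  · exact Or.inl ((pow_left_inj₀ hy0.le hβ0.le hr.ne').1 h)
  · rw [← inv_pow] at h
    exact Or.inr ((pow_left_inj₀ hy0.le (inv_nonneg.2 hβ0.le) hr.ne').1 h)

theorem pos_of_alexander (hn : 0 < n) {y : ℝ} (hy : (n : ℝ) * y ^ 2 - (2 * n + 1) * y + n = 0) :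
    0 < y := by
  have hnR : (0 : ℝ) < n := by exact_mod_cast hn
  by_contra h
  nlinarith [sq_nonneg y, mul_nonneg hnR.le (sq_nonneg y)]

end Real

/-- At `1`, `-1` and `±i` the Alexander polynomial takes the values `-1`, `4n+1` and `∓(2n+1)i`. -/
theorem aeval_I_ne_zero {n : ℤ} (r : ℕ) :
    (n : ℂ) * (Complex.I ^ r) ^ 2 - (2 * n + 1) * Complex.I ^ r + n ≠ 0 := by
  intro h
  set y := Complex.I ^ r with hy
  have hy4 : (y ^ 2 - 1) * (y ^ 2 + 1) = 0 := by
    have : y ^ 4 = 1 := by rw [hy, ← pow_mul, mul_comm, pow_mul, Complex.I_pow_four, one_pow]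
    linear_combination this
  have hy0 : y ≠ 0 := pow_ne_zero _ Complex.I_ne_zero
  rcases mul_eq_zero.1 hy4 with h2 | h2
  · have h3 : ((4 * n + 1 : ℤ) : ℂ) = 0 := by
      push_cast
      linear_combination -(n * y ^ 2 + n + (2 * n + 1) * y) * h +
        (n ^ 2 * (y ^ 2 + 3) - (2 * n + 1) ^ 2) * h2
    have : 4 * n + 1 = 0 := by exact_mod_cast h3
    omega
  · have h3 : ((2 * n + 1 : ℤ) : ℂ) * y = 0 := by
      push_cast
      linear_combination n * h2 - h
    have h4 : 2 * n + 1 = 0 := by exact_mod_cast (mul_eq_zero.1 h3).resolve_right hy0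
    omega

end TwistKnot

/-! ## Real polynomials with a single positive root -/

namespace Polynomial

theorem eq_expand_of_comp_neg_X {h : ℚ[X]} (hh : h.comp (-X) = h) :
    expand ℚ 2 (contract 2 h) = h := by
  ext k
  rw [coeff_expand two_pos]
  split_ifs with hk
  · rw [coeff_contract two_ne_zero, Nat.div_mul_cancel hk]
  · have h1 : (h.comp (-X)).coeff k = h.coeff k * (-1) ^ k := by
      rw [← comp_C_mul_X_coeff]
      simp
    rw [hh, Odd.neg_one_pow (by rwa [← Nat.not_even_iff_odd, even_iff_two_dvd])] at h1
    linarith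

theorem exists_aeval_pos {h : ℚ[X]} (hm : h.Monic) (hd : 0 < h.natDegree) (x : ℝ) :
    ∃ y, x < y ∧ 0 < aeval y h := by
  have := tendsto_atTop_of_leadingCoeff_nonneg (h.map (algebraMap ℚ ℝ))
    (by rw [degree_map]; exact natDegree_pos_iff_degree_pos.1 hd)
    (by rw [(hm.map _).leadingCoeff]; exact zero_le_one)
  obtain ⟨y, hy1, hy2⟩ := ((this.eventually_gt_atTop 0).and (Filter.eventually_gt_atTop x)).exists
  exact ⟨y, hy2, by rwa [eval_map_algebraMap] at hy1⟩

theorem exists_root_of_sign_change {h : ℚ[X]} {x y : ℝ} (hxy : x ≤ y)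
    (hs : aeval x h * aeval y h < 0) : ∃ z ∈ Set.Icc x y, aeval z h = 0 := by
  have hc : ContinuousOn (fun t : ℝ => aeval t h) (Set.Icc x y) := by fun_prop
  rcases mul_neg_iff.1 hs with ⟨h1, h2⟩ | ⟨h1, h2⟩
  · exact intermediate_value_Icc' hxy hc ⟨h2.le, h1.le⟩
  · exact intermediate_value_Icc hxy hc ⟨h1.le, h2.le⟩

/-- An irreducible polynomial with exactly one positive root is negative at zero. -/
theorem aeval_zero_neg_of_unique_root {h : ℚ[X]} (hm : h.Monic) (hirr : Irreducible h) {β : ℝ}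
    (hβ0 : 0 < β) (hβ : aeval β h = 0) (huniq : ∀ y : ℝ, 0 ≤ y → aeval y h = 0 → y = β) :
    aeval (0 : ℝ) h < 0 := by
  by_contra hneg
  have h0 : 0 < aeval (0 : ℝ) h :=
    lt_of_le_of_ne (not_lt.1 hneg) fun h0 => hβ0.ne (huniq 0 le_rfl h0.symm)
  -- A negative value at `x` would produce roots on both sides of `x`; both would be `β`, so `x =
  -- β`, where the value is zero.
  have hnn : ∀ x : ℝ, 0 < x → 0 ≤ aeval x h := by
    intro x hx
    by_contra hx'
    rw [not_le] at hx'
    obtain ⟨z, hz, hz0⟩ := exists_root_of_sign_change hx.le (mul_neg_of_pos_of_neg h0 hx')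
    have hz1 := huniq z hz.1 hz0
    obtain ⟨y, hxy, hy⟩ := exists_aeval_pos hm hirr.natDegree_pos x
    obtain ⟨w, hw, hw0⟩ := exists_root_of_sign_change hxy.le (mul_neg_of_neg_of_pos hx' hy)
    have hw1 := huniq w (hx.le.trans hw.1) hw0
    have hxβ : x = β := le_antisymm (hw1 ▸ hw.1) (hz1 ▸ hz.2)
    rw [hxβ, hβ] at hx'
    exact lt_irrefl _ hx'
  -- A minimum at a root is a multiple root, which separability excludes.
  have hmin : IsLocalMin (fun x : ℝ => aeval x h) β := by
    filter_upwards [lt_mem_nhds hβ0] with x hx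
    rw [hβ]
    exact hnn x hx
  have hder := hmin.deriv_eq_zero
  rw [Polynomial.deriv_aeval] at hder
  exact hirr.separable.aeval_derivative_ne_zero hβ hder

theorem exists_negative_root {h : ℚ[X]} (hm : h.Monic) (hd : 0 < h.natDegree)
    (heven : Even h.natDegree) (h0 : aeval (0 : ℝ) h < 0) : ∃ y : ℝ, y < 0 ∧ aeval y h = 0 := by
  have hm' : (h.comp (-X)).Monic := by
    rw [Monic, comp_neg_X_leadingCoeff_eq, hm.leadingCoeff, heven.neg_one_pow, one_mul]
  obtain ⟨y, hy0, hy⟩ := exists_aeval_pos hm' (by simpa [natDegree_comp] using hd) 0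
  rw [aeval_comp, map_neg, aeval_X] at hy
  obtain ⟨z, hz, hz0⟩ := exists_root_of_sign_change (neg_nonpos.2 hy0.le)
    (mul_neg_of_pos_of_neg hy h0)
  refine ⟨z, lt_of_le_of_ne hz.2 ?_, hz0⟩
  rintro rfl
  exact h0.ne hz0

/-- If the inverse of the negative of a root is also a root, and the polynomial is irreducible of
degree divisible by four and negative at zero, then it vanishes at the imaginary unit. -/
theorem aeval_I_eq_zero {β : ℝ} (hint : IsIntegral ℚ β) (hβ0 : β ≠ 0)
    (h4 : 4 ∣ (minpoly ℚ β).natDegree) (h0 : aeval (0 : ℝ) (minpoly ℚ β) < 0)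
    (hroot : aeval (-β⁻¹) (minpoly ℚ β) = 0) : aeval Complex.I (minpoly ℚ β) = 0 := by
  set h := minpoly ℚ β with hh
  have hm : h.Monic := minpoly.monic hint
  have hI4 : Complex.I ^ h.natDegree = 1 := by
    obtain ⟨k, hk⟩ := h4
    rw [hk, pow_mul, Complex.I_pow_four, one_pow]
  have heven : Even h.natDegree := by
    rw [even_iff_two_dvd]
    omega
  have hc0 : h.coeff 0 < 0 := by
    rw [← coeff_zero_eq_aeval_zero' h] at h0
    simpa using h0
  -- The roots of the right side are the numbers `-z⁻¹` with `z` a nonzero root of `h`. It vanishes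
  -- at `β`, so equality of degrees makes it a constant multiple of `h`.
  have hdvd : h ∣ h.reverse.comp (-X) := by
    refine minpoly.dvd ℚ β ?_
    rw [aeval_comp, map_neg, aeval_X]
    let := invertibleOfNonzero (neg_ne_zero.2 (inv_ne_zero hβ0))
    have := (eval₂_reverse_eq_zero_iff (algebraMap ℚ ℝ) (-β⁻¹) h).2 hroot
    rwa [invOf_eq_inv, inv_neg, inv_inv] at this
  have hrdeg : h.reverse.natDegree = h.natDegree := by
    rw [reverse_natDegree, natTrailingDegree_eq_zero.2 (Or.inr hc0.ne), Nat.sub_zero]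
  obtain ⟨q, hq⟩ := hdvd
  have hr0 : h.reverse.comp (-X) ≠ 0 := by
    rw [← leadingCoeff_ne_zero, comp_neg_X_leadingCoeff_eq]
    refine mul_ne_zero (pow_ne_zero _ (by norm_num)) ?_
    rw [leadingCoeff_ne_zero, Ne, reverse_eq_zero]
    exact hm.ne_zero
  have hq0 : q ≠ 0 := by
    rintro rfl
    exact hr0 (by rw [hq, mul_zero])
  have hqdeg : q.natDegree = 0 := by
    have h1 := natDegree_mul hm.ne_zero hq0
    rw [← hq, natDegree_comp, natDegree_neg, natDegree_X, hrdeg] at h1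
    omega
  obtain ⟨c, rfl⟩ := natDegree_eq_zero.1 hqdeg
  have hc : c = h.coeff 0 := by
    have h1 := congrArg leadingCoeff hq
    rwa [comp_neg_X_leadingCoeff_eq, hrdeg, heven.neg_one_pow, one_mul, reverse_leadingCoeff,
      leadingCoeff_mul, hm.leadingCoeff, one_mul, leadingCoeff_C, trailingCoeff,
      natTrailingDegree_eq_zero.2 (Or.inr hc0.ne), eq_comm] at h1
  -- Comparing constant coefficients gives `c² = 1`, and `c = h(0)` is negative.
  have hc1 : c = -1 := by
    have h1 := congrArg (fun p => coeff p 0) hq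
    simp only [coeff_mul_C] at h1
    rw [coeff_zero_eq_eval_zero, eval_comp, eval_neg, eval_X, neg_zero, ← coeff_zero_eq_eval_zero,
      coeff_zero_reverse, hm.leadingCoeff, ← hc] at h1
    rw [← hc] at hc0
    nlinarith
  have h1 := congrArg (aeval Complex.I) hq
  rw [hc1, aeval_comp, map_neg, aeval_X, map_mul, aeval_C] at h1
  let := invertibleOfNonzero Complex.I_ne_zero
  -- As `i⁻¹ = -i` and `i ^ deg h = 1`, the reverse takes at `-i` the value `h(i)`; by `h1` it also
  -- takes the value `-h(i)`.
  have h2 := eval₂_reverse_mul_pow (algebraMap ℚ ℂ) Complex.I h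
  rw [invOf_eq_inv, Complex.inv_I, hI4, mul_one, ← aeval_def, ← aeval_def, h1] at h2
  simp at h2
  linear_combination -h2 / 2

end Polynomial

/-! ### Positive roots are conjugate to their inverses -/

namespace TwistKnot

open Polynomial IntermediateField

/-- If neither `n` nor `4 n + 1` is a square, the positive roots of the Alexander polynomial in
`X ^ r` are conjugate to their inverses. -/
theorem aeval_inv_minpoly {n : ℤ} (hn : 0 < n) (h1 : ¬ IsSquare n) (h4 : ¬ IsSquare (4 * n + 1))
    {r : ℕ} (hr : 0 < r) {β : ℝ} (hβ0 : 0 < β)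
    (hβ : (n : ℝ) * (β ^ r) ^ 2 - (2 * n + 1) * β ^ r + n = 0) :
    aeval β⁻¹ (minpoly ℚ β) = 0 := by
  induction r using Nat.strong_induction_on generalizing β with
  | _ r ih =>
  by_contra hne
  have hint := isIntegral_of_alexander hn.ne' hr hβ
  have hm := minpoly.monic hint
  have hpos := minpoly.natDegree_pos hint
  have hirr := minpoly.irreducible hint
  -- The field `ℚ(β)` contains `β ^ r`, which is quadratic because `4n+1` is not a square.
  have heven : Even (minpoly ℚ β).natDegree := by
    have := natDegree_minpoly_dvd_of_mem (hint.pow r) hint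
      (pow_mem (mem_adjoin_simple_self ℚ β) r)
    rwa [natDegree_minpoly_root hn h4 hβ, ← even_iff_two_dvd] at this
  -- The only positive candidates are `β` and `β⁻¹`, and the latter is excluded by assumption.
  have hzero : aeval (0 : ℝ) (minpoly ℚ β) < 0 := by
    refine aeval_zero_neg_of_unique_root hm hirr hβ0 (minpoly.aeval ℚ β) fun y hy0 hy => ?_
    have hy' := alexander_root_of_minpoly_root hβ hy
    have hy0' : 0 < y := by
      refine lt_of_le_of_ne hy0 ?_
      rintro rfl
      have := pos_of_alexander hn hy'
      rw [zero_pow hr.ne'] at this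
      exact lt_irrefl _ this
    rcases eq_or_eq_inv_of_pow_alexander hn hr hβ0 hβ hy0' hy' with h | h
    · exact h
    · exact absurd (h ▸ hy) hne
  obtain ⟨y, hy0, hy⟩ := exists_negative_root hm hpos heven hzero
  have hy' := alexander_root_of_minpoly_root hβ hy
  have hreven : Even r := by
    by_contra hodd
    rw [Nat.not_even_iff_odd] at hodd
    exact (pos_of_alexander hn hy').not_gt (hodd.pow_neg hy0)
  obtain ⟨m, hm2⟩ := hreven
  have hrm : r = 2 * m := by omega
  rcases eq_or_eq_inv_of_pow_alexander hn hr hβ0 hβ (neg_pos.2 hy0)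
    (by rwa [Even.neg_pow ⟨m, hm2⟩]) with h | h
  · obtain rfl : y = -β := by rw [← h, neg_neg]
    -- With `-β` also a root, the minimal polynomial is even, and the claim for `β` reduces to that
    -- for `β²` and `r / 2`.
    have hcomp : (minpoly ℚ β).comp (-X) = minpoly ℚ β := by
      refine eq_of_monic_of_dvd_of_natDegree_le hm ?_ ?_ ?_
      · rw [Monic, comp_neg_X_leadingCoeff_eq, hm.leadingCoeff, heven.neg_one_pow, one_mul]
      · refine minpoly.dvd ℚ β ?_
        rw [aeval_comp, map_neg, aeval_X, hy]
      · simp [natDegree_comp]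
    have hexp := eq_expand_of_comp_neg_X hcomp
    have hsq : (n : ℝ) * (((β ^ 2) ^ m) ^ 2) - (2 * n + 1) * (β ^ 2) ^ m + n = 0 := by
      rw [← pow_mul β 2 m, ← hrm]
      exact hβ
    have hind := ih m (by omega) (by omega) (pow_pos hβ0 2) hsq
    have hdvd : minpoly ℚ (β ^ 2) ∣ contract 2 (minpoly ℚ β) := by
      refine minpoly.dvd ℚ _ ?_
      rw [← expand_aeval, hexp, minpoly.aeval]
    apply hne
    rw [← hexp, expand_aeval, inv_pow]
    exact aeval_eq_zero_of_dvd_aeval_eq_zero hdvd hind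
  · obtain rfl : y = -β⁻¹ := by rw [← h, neg_neg]
    have hγ : (n : ℝ) * ((β ^ m) ^ 2) ^ 2 - (2 * n + 1) * (β ^ m) ^ 2 + n = 0 := by
      rw [← pow_mul β m 2, mul_comm m 2, ← hrm]
      exact hβ
    -- Since `β ^ m` is a square root of `β ^ r` and has degree four, four divides the degree of
    -- `β`.
    have hdvd := natDegree_minpoly_dvd_of_mem (hint.pow m) hint
      (pow_mem (mem_adjoin_simple_self ℚ β) m)
    rw [natDegree_minpoly_sq_root hn h1 h4 (pow_ne_zero m hβ0.ne') hγ] at hdvd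
    exact aeval_I_ne_zero r
      (alexander_root_of_minpoly_root hβ (aeval_I_eq_zero hint hβ0.ne' hdvd hzero hy))

end TwistKnot

/-! ## Twist knots that are not algebraically rationally slice -/

namespace TwistKnot

open Polynomial

theorem not_metabolic_of_pos {n : ℤ} (hn : 0 < n) (h1 : ¬ IsSquare n) (h4 : ¬ IsSquare (4 * n + 1))
    {r : ℕ} (hr : 0 < r) : ¬ RatForm.Metabolic (RatForm.parallel r (twistBilin n)) := by
  have hnR : (0 : ℝ) < n := by exact_mod_cast hn
  obtain ⟨α, hα0, hα⟩ : ∃ α : ℝ, 0 < α ∧ (n : ℝ) * α ^ 2 - (2 * n + 1) * α + n = 0 := by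
    obtain ⟨s, hs0, hs⟩ : ∃ s : ℝ, 0 ≤ s ∧ s ^ 2 = 4 * n + 1 :=
      ⟨√(4 * n + 1), Real.sqrt_nonneg _, Real.sq_sqrt (by positivity)⟩
    refine ⟨(2 * n + 1 + s) / (2 * n), by positivity, ?_⟩
    field_simp
    linear_combination hs
  obtain ⟨β, hβ0, rfl⟩ : ∃ β : ℝ, 0 < β ∧ β ^ r = α :=
    ⟨α ^ (r : ℝ)⁻¹, by positivity, Real.rpow_inv_natCast_pow hα0.le hr.ne'⟩
  have hint := isIntegral_of_alexander hn.ne' hr hα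
  have hmin : minpoly ℚ β = minpoly ℚ β⁻¹ :=
    minpoly.eq_of_irreducible_of_monic (minpoly.irreducible hint)
      (aeval_inv_minpoly hn h1 h4 hr hβ0 hα) (minpoly.monic hint)
  refine not_metabolic_of_conjugate hn.ne' hr hα fun q => ?_
  rw [← minpoly.dvd_iff, hmin, minpoly.dvd_iff]

/-- The discriminant `4n+1` is negative, so the roots are complex conjugates with product one. Hence
every `r`-th root `β` of one of them has norm one, and complex conjugation sends `β` to `β⁻¹`. -/
theorem not_metabolic_of_neg {n : ℤ} (hn : n < 0) {r : ℕ} (hr : 0 < r) :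
    ¬ RatForm.Metabolic (RatForm.parallel r (twistBilin n)) := by
  have hnR : (n : ℝ) ≠ 0 := by exact_mod_cast hn.ne
  obtain ⟨α, hnorm, hα⟩ : ∃ α : ℂ, ‖α‖ = 1 ∧ (n : ℂ) * α ^ 2 - (2 * n + 1) * α + n = 0 := by
    let a : ℝ := (2 * n + 1) / (2 * n)
    have ha : 0 ≤ 1 - a ^ 2 := by
      have h1 : 1 - a ^ 2 = -(4 * n + 1) / (2 * n) ^ 2 := by
        simp only [a]
        field_simp
        ring
      have h2 : (0 : ℝ) ≤ -(4 * n + 1) := by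
        have : (0 : ℤ) ≤ -(4 * n + 1) := by omega
        exact_mod_cast this
      rw [h1]
      positivity
    obtain ⟨b, hb⟩ : ∃ b : ℝ, b ^ 2 = 1 - a ^ 2 := ⟨√(1 - a ^ 2), Real.sq_sqrt ha⟩
    have hnorm : Complex.normSq ⟨a, b⟩ = 1 := by
      rw [Complex.normSq_mk]
      linear_combination hb
    have ha2 : 2 * n * a = 2 * n + 1 := by
      simp only [a]
      field_simp
    clear_value a
    refine ⟨⟨a, b⟩, ?_, ?_⟩
    · rw [Complex.norm_def, hnorm, Real.sqrt_one]
    · apply Complex.ext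
      · simp [pow_two]
        linear_combination a * ha2 - n * hb
      · simp [pow_two]
        linear_combination b * ha2
  obtain ⟨β, rfl⟩ := IsAlgClosed.exists_pow_nat_eq α hr
  have hβ : ‖β‖ = 1 := by
    rw [norm_pow] at hnorm
    exact (pow_eq_one_iff_of_nonneg (norm_nonneg β) hr.ne').1 hnorm
  refine not_metabolic_of_conjugate hn.ne hr hα fun q => ?_
  have h : aeval β⁻¹ q = Complex.conjAe (aeval β q) := by
    rw [Complex.inv_eq_conj hβ]
    exact aeval_algHom_apply (Complex.conjAe.restrictScalars ℚ) β q
  rw [h, map_eq_zero_iff _ Complex.conjAe.injective]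

/-! ## Twist knots that are algebraically rationally slice -/

theorem metabolic_mul_pred (k : ℤ) : RatForm.Metabolic (twistBilin (k * (k - 1))) := by
  -- The associated quadratic form is `-(x + ky)(x - (k-1)y)`.
  refine ⟨Submodule.span ℚ {((k : ℚ) - 1, (1 : ℚ))}, ?_, ?_⟩
  · rw [finrank_span_singleton (by simp), Module.finrank_prod]
    simp
  · intro x hx y hy
    obtain ⟨a, rfl⟩ := Submodule.mem_span_singleton.1 hx
    obtain ⟨b, rfl⟩ := Submodule.mem_span_singleton.1 hy
    simp [twistBilin_apply]
    ring

theorem metabolic_sq {k : ℤ} (hk : k ≠ 0) :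
    RatForm.Metabolic (RatForm.parallel 2 (twistBilin (k ^ 2))) := by
  have hk' : (k : ℚ) ≠ 0 := by exact_mod_cast hk
  -- With `t` the monodromy of one copy and `T` that of two copies, the range is the kernel of `kT²
  -- + T - k`, one factor of `Δ(T²)`. Equivalently, it is the graph of `-k(t - 1)` from the first
  -- copy to the second, in convenient coordinates.
  let g : ℚ × ℚ →ₗ[ℚ] (Fin 2 → ℚ × ℚ) :=
    { toFun := fun u => ![(-(k : ℚ) ^ 2 * u.2, k * u.1 - u.2),
        (-(k : ℚ) ^ 2 * u.1 + k * u.2, -u.1 + ((k : ℚ)⁻¹ + k) * u.2)]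
      map_add' := fun u w => by
        ext i <;> fin_cases i <;> simp <;> ring
      map_smul' := fun c u => by
        ext i <;> fin_cases i <;> simp <;> ring }
  refine ⟨LinearMap.range g, ?_, ?_⟩
  · rw [LinearMap.finrank_range_of_inj, Module.finrank_pi_fintype]
    · simp
    · rw [← LinearMap.ker_eq_bot, LinearMap.ker_eq_bot']
      intro u hu
      have h0 := congrFun hu 0
      have h1 : -(k : ℚ) ^ 2 * u.2 = 0 := congrArg Prod.fst h0
      have h2 : k * u.1 - u.2 = 0 := congrArg Prod.snd h0
      have h3 : u.2 = 0 := by simpa [hk'] using h1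
      exact Prod.ext (by simpa [h3, hk'] using h2) h3
  · rintro _ ⟨u, rfl⟩ _ ⟨w, rfl⟩
    rw [RatForm.parallel_apply]
    simp [Fin.sum_univ_two, twistBilin_apply, g]
    field_simp
    ring

theorem exists_eq_of_isSquare {n : ℤ} (h : IsSquare (4 * n + 1)) : ∃ k : ℤ, n = k * (k - 1) := by
  obtain ⟨m, hm⟩ := h
  rcases Int.even_or_odd' m with ⟨j, rfl | rfl⟩
  · exfalso
    have : 4 * n + 1 = 4 * (j * j) := by rw [hm]; ring
    omega
  · exact ⟨j + 1, by linarith⟩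

end TwistKnot

theorem mainTheorem5 (n : ℤ) :
    (twistKnot n).IsAlgRatSlice ↔ ∃ k : ℤ, n = k * (k - 1) ∨ n = k ^ 2 := by
  -- The case `n = 0` is separate: the homology of the surface is zero rather than two-dimensional.
  rcases eq_or_ne n 0 with rfl | hn
  · refine iff_of_true ?_ ⟨0, Or.inr (by norm_num)⟩
    refine ⟨SeifertForm.zero, TwistKnot.isSeifertForm_zero, ?_⟩
    exact map_zero (AddCommGroup.DirectLimit.of _ Complexity.map ⟨1⟩)
  rw [KnotDiagram.isAlgRatSlice_iff (TwistKnot.isSeifertForm_twistForm hn)]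
  constructor
  · rintro ⟨r, hr, h⟩
    rcases lt_or_gt_of_ne hn with hneg | hpos
    · exact absurd h (TwistKnot.not_metabolic_of_neg hneg hr)
    · by_contra hne
      refine TwistKnot.not_metabolic_of_pos hpos (fun h1 => ?_) (fun h4 => ?_) hr h
      · obtain ⟨k, hk⟩ := h1
        exact hne ⟨k, Or.inr (by rw [hk, sq])⟩
      · obtain ⟨k, hk⟩ := TwistKnot.exists_eq_of_isSquare h4
        exact hne ⟨k, Or.inl hk⟩
  · rintro ⟨k, rfl | rfl⟩
    · exact ⟨1, one_pos, (TwistKnot.metabolic_mul_pred k).parallel 1⟩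
    · exact ⟨2, two_pos, TwistKnot.metabolic_sq (by rintro rfl; exact hn (by norm_num))⟩
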